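/- Let $n\ge 4$ and $\alpha\ge 0$. Consider the $n\times n$ partial symmetric Toeplitz matrix with pattern $\{1,n-1\}$ and data $t_0=1+\alpha$, $t_1=\cos\frac{\pi}{n-1}$, $t_{n-1}=-1$; a completion of it is a real symmetric $n\times n$ matrix $X$ with $X_{ij}=t_{|i-j|}$ whenever $|i-j|\in\{0,1,n-1\}$. Then the following hold. (1) For $\alpha=0$ there is exactly one positive semidefinite completion, namely $\bar X=\bigl(\cos\frac{(i-j)\pi}{n-1}\bigr)_{i,j=0}^{n-1}$, and $\operatorname{rank}\bar X=2$. (2) For every $\alpha>0$ there is a unique positive definite completion $X(\alpha)$ whose determinant is maximal among all positive definite completions, and $\lim_{\alpha\searrow0}X(\alpha)=\bar X$. (3) The limit $\bar Z=\lim_{\alpha\searrow 0}\alpha X(\alpha)^{-1}$ exists. It is positive semidefinite, $\bar X\bar Z=0$, $\bar Z$ lies in $\operatorname{range}(\mathcal A^*)$, and $\operatorname{rank}\bar Z\le 1$. Consequently $\operatorname{rank}\bar X+\operatorname{rank}\bar Z\le 3<n$. (4) The singularity degree of the problem $\{X\succeq 0:\mathcal A(X)=b\}$ of finding a positive semidefinite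 completion for $\alpha=0$ is at least $2$. Here $\mathcal A$ is the linear map that sends a symmetric matrix $X$ to the vector of its entries $X_{ij}$, $i\le j$, $j-i\in\{0,1,n-1\}$, $b$ is the vector of the prescribed values, and $\mathcal A^*$ is the adjoint of $\mathcal A$ for the trace inner product. For a problem $\{X\succeq0:\mathcal A(X)=b\}$, an exposing vector is a nonzero positive semidefinite $Z\in\operatorname{range}(\mathcal A^*)$ with $ZX=0$ for all feasible $X$. A facial reduction step takes an exposing vector $Z$ of maximal rank and a matrix $V$ whose columns form a basis of $\ker Z$, and replaces the problem by $\{R\succeq0:\mathcal A(VRV^{T})=b\}$. The singularity degree is the number of steps needed to reach a problem with a positive definite feasible matrix. -/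

import Mathlib

open Filter Topology

noncomputable section

/-! ### Partial symmetric Toeplitz matrices and their completions -/

namespace ToeplitzCompletion

/-- `X` is a symmetric `n × n` matrix that agrees with the partial symmetric Toeplitz matrix with
pattern `P` and data `t`: for `k ∈ P ∪ {0}`, all the entries of the `k`-th diagonal are `t k`. -/
def IsCompletion (n : ℕ) (P : Finset ℕ) (t : ℕ → ℝ) (X : Matrix (Fin n) (Fin n) ℝ) : Prop :=
  X.IsSymm ∧ ∀ i j : Fin n, i ≤ j → (j : ℕ) - (i : ℕ) ∈ insert 0 P →
    X i j = t ((j : ℕ) - (i : ℕ))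

/-- The set of positive semidefinite completions. -/
def psdCompletions (n : ℕ) (P : Finset ℕ) (t : ℕ → ℝ) : Set (Matrix (Fin n) (Fin n) ℝ) :=
  {X | IsCompletion n P t X ∧ X.PosSemidef}

/-- `X` is a positive definite completion whose determinant is maximal among all positive definite
completions. -/
def IsMaxDetCompletion (n : ℕ) (P : Finset ℕ) (t : ℕ → ℝ) (X : Matrix (Fin n) (Fin n) ℝ) : Prop :=
  (IsCompletion n P t X ∧ X.PosDef) ∧
    ∀ Y : Matrix (Fin n) (Fin n) ℝ, IsCompletion n P t Y → Y.PosDef → Y.det ≤ X.det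

end ToeplitzCompletion

/-! ### Semidefinite feasibility problems, facial reduction and the singularity degree -/

/-- The data of a semidefinite feasibility problem `X ⪰ 0`, `tr (A_j X) = b_j` for `j ∈ J`, with
symmetric matrices `A_j`. -/
structure SDP (J ι : Type) where
  constraint : J → Matrix ι ι ℝ
  constraint_symm : ∀ j, (constraint j).IsSymm
  rhs : J → ℝ

namespace SDP

variable {J ι κ : Type} [Fintype ι]

/-- The feasible set. -/
def feasible (S : SDP J ι) : Set (Matrix ι ι ℝ) :=
  {X | X.PosSemidef ∧ ∀ j, (S.constraint j * X).trace = S.rhs j}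

/-- The Slater condition: some feasible matrix is positive definite. -/
def Slater (S : SDP J ι) : Prop := ∃ X ∈ S.feasible, X.PosDef

/-- `Z` is in the range of the adjoint `y ↦ ∑ j, y j • A_j` of the linear map
`X ↦ (tr (A_j X))_j`. -/
def InAdjointRange [Fintype J] (S : SDP J ι) (Z : Matrix ι ι ℝ) : Prop :=
  ∃ y : J → ℝ, ∑ j, y j • S.constraint j = Z

/-- A nonzero positive semidefinite `Z` in the range of the adjoint, orthogonal to every feasible
matrix. -/
def IsExposingVector [Fintype J] (S : SDP J ι) (Z : Matrix ι ι ℝ) : Prop :=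
  Z ≠ 0 ∧ Z.PosSemidef ∧ S.InAdjointRange Z ∧ ∀ X ∈ S.feasible, Z * X = 0

/-- The problem in the smaller matrix variable `R` that arises from the substitution
`X = V * R * Vᵀ`. -/
def restrict (S : SDP J ι) (V : Matrix ι κ ℝ) : SDP J κ where
  constraint j := V.transpose * S.constraint j * V
  constraint_symm j := by
    have h := S.constraint_symm j
    unfold Matrix.IsSymm at h ⊢
    simp [Matrix.transpose_mul, h, Matrix.mul_assoc]
  rhs := S.rhs

/-- `S.RegularizedIn k`: the Slater condition is reached after exactly `k` facial reduction steps.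
A step chooses an exposing vector `Z` of maximal rank and restricts the problem to the kernel of
`Z`, of which the columns of `V` are a basis. -/
inductive RegularizedIn [Fintype J] : {r : ℕ} → SDP J (Fin r) → ℕ → Prop
  | zero {r : ℕ} (S : SDP J (Fin r)) (h : S.Slater) : RegularizedIn S 0
  | succ {r s k : ℕ} (S : SDP J (Fin r)) (Z : Matrix (Fin r) (Fin r) ℝ)
      (V : Matrix (Fin r) (Fin s) ℝ)
      (hZ : S.IsExposingVector Z)
      (hmax : ∀ W : Matrix (Fin r) (Fin r) ℝ, S.IsExposingVector W → W.rank ≤ Z.rank)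
      (hinj : Function.Injective V.mulVec)
      (hker : LinearMap.range V.mulVecLin = LinearMap.ker Z.mulVecLin)
      (h : RegularizedIn (S.restrict V) k) : RegularizedIn S (k + 1)

/-- The singularity degree: the number of facial reduction steps needed to reach the Slater
condition (`⊤` if it is never reached). -/
def singularityDegree [Fintype J] {r : ℕ} (S : SDP J (Fin r)) : ℕ∞ :=
  ⨅ (k : ℕ) (_ : S.RegularizedIn k), (k : ℕ∞)

end SDP

namespace ToeplitzCompletion

/-- The index set of the specified entries on and above the main diagonal. -/
abbrev Specified (n : ℕ) (P : Finset ℕ) : Type :=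
  {p : Fin n × Fin n // p.1 ≤ p.2 ∧ (p.2 : ℕ) - (p.1 : ℕ) ∈ insert 0 P}

/-- The semidefinite feasibility problem of the positive semidefinite completions: one constraint
`X i j = t (j - i)` for each specified entry, written as `tr (E X) = t (j - i)` with the symmetric
matrix `E` supported on the entries `(i, j)` and `(j, i)`. -/
def completionSDP (n : ℕ) (P : Finset ℕ) (t : ℕ → ℝ) : SDP (Specified n P) (Fin n) where
  constraint p := (1 / 2 : ℝ) • (Matrix.single p.1.1 p.1.2 1 + Matrix.single p.1.2 p.1.1 1)
  constraint_symm p := by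
    unfold Matrix.IsSymm
    simp [Matrix.transpose_add, add_comm]
  rhs p := t ((p.1.2 : ℕ) - (p.1.1 : ℕ))

/-- The feasible set of `completionSDP` is the set of positive semidefinite completions. -/
theorem feasible_completionSDP (n : ℕ) (P : Finset ℕ) (t : ℕ → ℝ) :
    (completionSDP n P t).feasible = psdCompletions n P t := by
  have key : ∀ (X : Matrix (Fin n) (Fin n) ℝ), X.IsSymm → ∀ i j : Fin n,
      (((1 / 2 : ℝ) • (Matrix.single i j 1 + Matrix.single j i 1)) * X).trace = X i j := by
    intro X hX i j
    have h : X j i = X i j := hX.apply i j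
    rw [Matrix.smul_mul, Matrix.trace_smul, Matrix.add_mul, Matrix.trace_add,
      Matrix.trace_single_mul, Matrix.trace_single_mul, h]
    simp
    ring
  ext X
  constructor
  · rintro ⟨hX, hc⟩
    have hs : X.IsSymm := by simpa using hX.isHermitian
    refine ⟨⟨hs, fun i j hij hP => ?_⟩, hX⟩
    rw [← key X hs i j]
    exact hc ⟨(i, j), hij, hP⟩
  · rintro ⟨⟨hs, hc⟩, hX⟩
    refine ⟨hX, fun p => ?_⟩
    exact (key X hs p.1.1 p.1.2).trans (hc p.1.1 p.1.2 p.2.1 p.2.2)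

/-- The data `t 0 = 1 + α`, `t 1 = cos (π / (n - 1))`, `t (n - 1) = -1` of the partial Toeplitz
matrix with pattern `{1, n - 1}`; the other values of this function are not used. -/
def cycleData (n : ℕ) (α : ℝ) (k : ℕ) : ℝ :=
  if k = 0 then 1 + α else if k = 1 then Real.cos (Real.pi / ((n : ℝ) - 1)) else -1

/-- The Toeplitz matrix with entries `cos ((i - j) π / (n - 1))`. -/
def cosMatrix (n : ℕ) : Matrix (Fin n) (Fin n) ℝ :=
  Matrix.of fun i j => Real.cos ((((i : ℕ) : ℝ) - ((j : ℕ) : ℝ)) * Real.pi / ((n : ℝ) - 1))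

end ToeplitzCompletion

end

/-!
Write `n = m + 1` and `θ = π / m`.

*The problem at `α = 0`.* A positive semidefinite completion is the Gram matrix of unit vectors
`v₀, …, v_m` with consecutive angles `θ` and with `v_m = -v₀`. The angles along the way add up to
`π`, so the triangle inequality for angles is sharp throughout and all inner products are determined
(`angle_eq_of_angle_succ`, `psdCompletions_zero`). A matrix `Z` in the range of the adjoint is
supported on the cycle `0, 1, …, m, 0`. Reading `Z * cosMatrix = 0` row by row shows that `Z` is a
multiple of `w wᵀ`, where `w` has ones in its first and last coordinates
(`InCyclePattern.eq_smul_of_mul_cosMatrix_eq_zero`). As the only feasible matrix has rank two, one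
facial reduction step with such a `Z` of rank one cannot reach the Slater condition.

*Maximum determinants.* The basic tool is `eq_of_trace_inv_mul_le_of_det_le`: if `tr (X⁻¹ Y) ≤ n` and
`det X ≤ det Y`, then `Y = X`. Applied at the midpoint of two maximizers it gives uniqueness, while
existence is compactness. It also shows that a positive definite completion whose inverse is supported
on the cycle is the maximizer.

*The limit `α → 0`.* For `φ < θ` close to `θ`, let `x` be the solution of
`x (t - 1) + x (t + 1) = 2 cos φ * x t` with `x 1 = cos θ` and `x m = -1`. The Toeplitz matrix with
entries `x |i - j|` is a completion for `1 + α = x 0`, and its inverse is an explicit matrix supported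
on the cycle (`waveInv_mul`). It is positive definite by block elimination: the interior block of the
inverse is a positive tridiagonal matrix, and the block of the Toeplitz matrix itself at the indices
`0, m` has diagonal `1 + α` and off-diagonal `-1`. Hence it is the maximizer. All small `α > 0` arise in
this way, by the intermediate value theorem. As `φ → θ`, `α` vanishes to second order in `θ - φ`, the
off-diagonal entry of the inverse grows like `1 / (θ - φ)` and its corner entry like
`1 / (θ - φ) ^ 2`; so `α X(α)⁻¹` tends to a multiple of `w wᵀ`, and the multiple is `m / 4`.
-/

namespace ToeplitzCompletion

open scoped Matrix

/-! ### Determinant maximization -/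

open scoped MatrixOrder in
/-- The equality case of the inequality between the arithmetic and the geometric mean of the
eigenvalues of `X⁻¹ * Y`. -/
theorem eq_of_trace_inv_mul_le_of_det_le {ι : Type*} [Fintype ι] [DecidableEq ι]
    {X Y : Matrix ι ι ℝ} (hX : X.PosDef) (hY : Y.PosDef)
    (htr : (X⁻¹ * Y).trace ≤ Fintype.card ι) (hdet : X.det ≤ Y.det) : Y = X := by
  -- with `X⁻¹ = Bᴴ B`, the inequality is applied to the positive definite matrix `B Y Bᴴ`
  obtain ⟨B, hB⟩ := CStarAlgebra.nonneg_iff_eq_star_mul_self.mp hX.inv.posSemidef.nonneg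
  have hXu : IsUnit X.det := hX.det_pos.ne'.isUnit
  have hdetB : X.det * (B.det * B.det) = 1 := by
    have h : (X * X⁻¹).det = 1 := by rw [Matrix.mul_nonsing_inv _ hXu, Matrix.det_one]
    rw [hB, Matrix.det_mul, Matrix.det_mul, Matrix.star_eq_conjTranspose,
      Matrix.det_conjTranspose] at h
    simpa using h
  have hB0 : B.det ≠ 0 := by
    intro h
    simp [h] at hdetB
  have hBu : IsUnit B := (Matrix.isUnit_iff_isUnit_det B).2 hB0.isUnit
  have hP : (B * Y * Bᴴ).PosDef := by
    refine hY.mul_mul_conjTranspose_same ?_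
    exact Matrix.vecMul_injective_iff_isUnit.2 hBu
  have htrP : (B * Y * Bᴴ).trace ≤ Fintype.card ι := by
    rw [Matrix.trace_mul_comm, ← Matrix.mul_assoc, ← Matrix.star_eq_conjTranspose, ← hB]
    exact htr
  have hdetP : 1 ≤ (B * Y * Bᴴ).det := by
    rw [Matrix.det_mul, Matrix.det_mul, Matrix.det_conjTranspose, star_trivial]
    nlinarith [mul_self_nonneg B.det]
  set lam := hP.1.eigenvalues with hlam
  have hpos : ∀ i, 0 < lam i := hP.eigenvalues_pos
  have hsum : ∑ i, (lam i - 1) ≤ 0 := by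
    have := hP.1.trace_eq_sum_eigenvalues
    simp only [RCLike.ofReal_real_eq_id, id] at this
    rw [Finset.sum_sub_distrib]
    simp only [Finset.sum_const, Finset.card_univ, nsmul_eq_mul, mul_one]
    linarith
  have hprod : 0 ≤ ∑ i, Real.log (lam i) := by
    rw [← Real.log_prod fun i _ => (hpos i).ne']
    refine Real.log_nonneg ?_
    have := hP.1.det_eq_prod_eigenvalues
    simp only [RCLike.ofReal_real_eq_id, id] at this
    rwa [this] at hdetP
  have hone : ∀ i, lam i = 1 := by
    by_contra! h
    obtain ⟨i, hi⟩ := h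
    have : ∑ i, Real.log (lam i) < ∑ i, (lam i - 1) :=
      Finset.sum_lt_sum (fun j _ => Real.log_le_sub_one_of_pos (hpos j))
        ⟨i, Finset.mem_univ _, Real.log_lt_sub_one_of_pos (hpos i) hi⟩
    linarith
  have hP1 : B * Y * Bᴴ = 1 := by
    rw [hP.1.spectral_theorem]
    have : (RCLike.ofReal ∘ hP.1.eigenvalues : ι → ℝ) = 1 := by
      funext i
      exact hone i
    rw [this]
    have h1 : Matrix.diagonal (1 : ι → ℝ) = 1 := Matrix.diagonal_one
    rw [h1, map_one]
  have h2 : X⁻¹ * Y = 1 := by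
    have h3 : (Bᴴ * B * Y) * Bᴴ = 1 * Bᴴ := by
      rw [Matrix.mul_assoc, Matrix.mul_assoc, ← Matrix.mul_assoc B, hP1, Matrix.mul_one,
        Matrix.one_mul]
    have h4 : IsUnit Bᴴ := by
      rw [← Matrix.star_eq_conjTranspose]
      exact hBu.star
    rw [hB, Matrix.star_eq_conjTranspose]
    exact h4.mul_right_cancel h3
  calc Y = X * (X⁻¹ * Y) := (Matrix.mul_nonsing_inv_cancel_left _ _ hXu).symm
    _ = X := by rw [h2, Matrix.mul_one]

variable {n : ℕ} {P : Finset ℕ} {t : ℕ → ℝ}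

theorem IsCompletion.smul_add_smul {X Y : Matrix (Fin n) (Fin n) ℝ} {a b : ℝ}
    (hX : IsCompletion n P t X) (hY : IsCompletion n P t Y) (hab : a + b = 1) :
    IsCompletion n P t (a • X + b • Y) := by
  refine ⟨(hX.1.smul a).add (hY.1.smul b), fun i j hij h => ?_⟩
  rw [Matrix.add_apply, Matrix.smul_apply, Matrix.smul_apply, hX.2 i j hij h, hY.2 i j hij h,
    ← add_smul, hab, one_smul]

/-- For the midpoint `Z` of two maximizers `X` and `Y`, the traces of `Z⁻¹ * X` and `Z⁻¹ * Y` have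
sum `2 n`, so that one of them is at most `n`. -/
theorem IsMaxDetCompletion.unique {X Y : Matrix (Fin n) (Fin n) ℝ}
    (hX : IsMaxDetCompletion n P t X) (hY : IsMaxDetCompletion n P t Y) : X = Y := by
  set Z : Matrix (Fin n) (Fin n) ℝ := (1 / 2 : ℝ) • X + (1 / 2 : ℝ) • Y with hZ
  have hZc : IsCompletion n P t Z := hX.1.1.smul_add_smul hY.1.1 (by norm_num)
  have hZp : Z.PosDef := (hX.1.2.smul (by norm_num : (0 : ℝ) < 1 / 2)).add
    (hY.1.2.smul (by norm_num : (0 : ℝ) < 1 / 2))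
  have hsum : (Z⁻¹ * X).trace + (Z⁻¹ * Y).trace = 2 * n := by
    have h : (Z⁻¹ * Z).trace = n := by
      rw [Matrix.nonsing_inv_mul _ hZp.det_pos.ne'.isUnit, Matrix.trace_one, Fintype.card_fin]
    nth_rewrite 2 [hZ] at h
    rw [Matrix.mul_add, Matrix.trace_add, Matrix.mul_smul, Matrix.mul_smul, Matrix.trace_smul,
      Matrix.trace_smul] at h
    simp only [smul_eq_mul] at h
    linarith
  rcases le_total (Z⁻¹ * X).trace n with h | h
  · have := eq_of_trace_inv_mul_le_of_det_le hZp hX.1.2 (by simpa using h) (hX.2 Z hZc hZp)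
    have h2 : X = (1 / 2 : ℝ) • X + (1 / 2 : ℝ) • Y := this
    ext i j
    have h3 := congrFun (congrFun h2 i) j
    simp only [Matrix.add_apply, Matrix.smul_apply, smul_eq_mul] at h3
    linarith
  · have := eq_of_trace_inv_mul_le_of_det_le hZp hY.1.2
      (by simpa using (by linarith : (Z⁻¹ * Y).trace ≤ n)) (hY.2 Z hZc hZp)
    have h2 : Y = (1 / 2 : ℝ) • X + (1 / 2 : ℝ) • Y := this
    ext i j
    have h3 := congrFun (congrFun h2 i) j
    simp only [Matrix.add_apply, Matrix.smul_apply, smul_eq_mul] at h3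
    linarith

theorem abs_apply_le_of_posSemidef {ι : Type*} [Fintype ι] [DecidableEq ι] {X : Matrix ι ι ℝ}
    (hX : X.PosSemidef) (i j : ι) : |X i j| ≤ (X i i + X j j) / 2 := by
  have hsym : X j i = X i j := by simpa using hX.1.apply i j
  have key : ∀ c : ℝ, 0 ≤ X i i + c * X i j * 2 + c * c * X j j := by
    intro c
    have h := hX.dotProduct_mulVec_nonneg (Pi.single i 1 + c • Pi.single j 1)
    simp only [star_trivial, Matrix.mulVec_add, Matrix.mulVec_smul, add_dotProduct,
      dotProduct_add, smul_dotProduct, dotProduct_smul, Matrix.mulVec_single_one,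
      single_dotProduct, one_mul, Matrix.col_apply, smul_eq_mul, hsym] at h
    linarith
  have h1 := key 1
  have h2 := key (-1)
  rw [abs_le]
  constructor <;> linarith

theorem isClosed_setOf_posSemidef {ι : Type*} [Fintype ι] :
    IsClosed {X : Matrix ι ι ℝ | X.PosSemidef} := by
  simp only [Matrix.posSemidef_iff_dotProduct_mulVec, Set.ofPred_and, Set.ofPred_forall,
    Matrix.IsHermitian]
  refine IsClosed.inter ?_ (isClosed_iInter fun x => ?_)
  · exact isClosed_eq (by fun_prop) continuous_id
  · exact isClosed_le continuous_const (by fun_prop)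

theorem isCompact_psdCompletions : IsCompact (psdCompletions n P t) := by
  have hclosed : IsClosed (psdCompletions n P t) := by
    refine IsClosed.inter (IsClosed.inter ?_ ?_) isClosed_setOf_posSemidef
    · exact isClosed_eq (f := fun X : Matrix (Fin n) (Fin n) ℝ => X.transpose) (by fun_prop)
        continuous_id
    · change IsClosed {X : Matrix (Fin n) (Fin n) ℝ | ∀ i j : Fin n, i ≤ j →
        (j : ℕ) - (i : ℕ) ∈ insert 0 P → X i j = t ((j : ℕ) - (i : ℕ))}
      simp only [Set.ofPred_forall]
      refine isClosed_iInter fun i => isClosed_iInter fun j => isClosed_iInter fun _ =>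
        isClosed_iInter fun _ => isClosed_eq (by fun_prop) continuous_const
  have hK : IsCompact (Set.pi Set.univ fun _ : Fin n => Set.pi Set.univ fun _ : Fin n =>
      Set.Icc (-t 0) (t 0)) :=
    isCompact_univ_pi fun _ => isCompact_univ_pi fun _ => isCompact_Icc
  refine hK.of_isClosed_subset hclosed fun X hX i _ j _ => ?_
  have hd : ∀ i, X i i = t 0 := fun i => by simpa using hX.1.2 i i le_rfl (by simp)
  have h := abs_apply_le_of_posSemidef hX.2 i j
  rw [hd, hd, abs_le] at h
  exact ⟨by linarith, by linarith⟩

/-- The determinant attains its maximum on the compact set of positive semidefinite completions,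
and a completion of positive determinant is positive definite. -/
theorem existsUnique_isMaxDetCompletion {Y : Matrix (Fin n) (Fin n) ℝ}
    (hY : IsCompletion n P t Y) (hYp : Y.PosDef) : ∃! X, IsMaxDetCompletion n P t X := by
  obtain ⟨X, hX, hmax⟩ := (isCompact_psdCompletions (n := n) (P := P) (t := t)).exists_isMaxOn
    ⟨Y, hY, hYp.posSemidef⟩ (f := Matrix.det) (Continuous.continuousOn (by fun_prop))
  refine ⟨X, ⟨⟨hX.1, hX.2.posDef_iff_det_ne_zero.2 ?_⟩, fun Z hZ hZp =>
    hmax ⟨hZ, hZp.posSemidef⟩⟩, fun Z hZ => hZ.unique ?_⟩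
  · exact (hYp.det_pos.trans_le (hmax ⟨hY, hYp.posSemidef⟩)).ne'
  · exact ⟨⟨hX.1, hX.2.posDef_iff_det_ne_zero.2
      (hYp.det_pos.trans_le (hmax ⟨hY, hYp.posSemidef⟩)).ne'⟩, fun Z hZ hZp =>
      hmax ⟨hZ, hZp.posSemidef⟩⟩

/-! ### The completion problem without slack -/

theorem cosMatrix_succ_apply (m : ℕ) (i j : Fin (m + 1)) :
    cosMatrix (m + 1) i j = Real.cos (((i : ℝ) - (j : ℝ)) * (Real.pi / m)) := by
  simp [cosMatrix, mul_div_assoc]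

theorem cycleData_zero (n : ℕ) (α : ℝ) : cycleData n α 0 = 1 + α := by simp [cycleData]

theorem cycleData_one (m : ℕ) (α : ℝ) : cycleData (m + 1) α 1 = Real.cos (Real.pi / m) := by
  simp [cycleData]

theorem cycleData_of_two_le (n : ℕ) (α : ℝ) {k : ℕ} (hk : 2 ≤ k) : cycleData n α k = -1 := by
  simp [cycleData, show k ≠ 0 by omega, show k ≠ 1 by omega]

/-- `cosMatrix` is the Gram matrix of the points `(cos (i π / m), sin (i π / m))`. -/
theorem cosMatrix_eq_mul_transpose (m : ℕ) : ∃ B : Matrix (Fin (m + 1)) (Fin 2) ℝ,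
    cosMatrix (m + 1) = B * Bᵀ := by
  refine ⟨Matrix.of fun i => ![Real.cos (i * (Real.pi / m)), Real.sin (i * (Real.pi / m))], ?_⟩
  ext i j
  rw [cosMatrix_succ_apply, sub_mul, Real.cos_sub]
  simp [Matrix.mul_apply, Fin.sum_univ_two]

theorem posSemidef_cosMatrix (m : ℕ) : (cosMatrix (m + 1)).PosSemidef := by
  obtain ⟨B, hB⟩ := cosMatrix_eq_mul_transpose m
  rw [hB]
  exact Matrix.posSemidef_self_mul_conjTranspose B

theorem isCompletion_cosMatrix {m : ℕ} (hm : 2 ≤ m) :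
    IsCompletion (m + 1) {1, m} (cycleData (m + 1) 0) (cosMatrix (m + 1)) := by
  have hm0 : (m : ℝ) ≠ 0 := by positivity
  refine ⟨by simpa using (posSemidef_cosMatrix m).1, fun i j hij h => ?_⟩
  have hij' : (i : ℕ) ≤ j := hij
  rw [cosMatrix_succ_apply, ← Real.cos_neg, ← neg_mul, neg_sub, ← Nat.cast_sub hij']
  simp only [Finset.mem_insert, Finset.mem_singleton] at h
  rcases h with h | h | h <;> rw [h]
  · simp [cycleData_zero]
  · simp [cycleData_one]
  · rw [cycleData_of_two_le _ _ hm, mul_div_cancel₀ _ hm0, Real.cos_pi]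

open InnerProductGeometry in
/-- Unit vectors whose consecutive angles are `π / m` and whose first and last members are opposite
lie on a half circle: the triangle inequality for angles is an equality throughout. -/
theorem angle_eq_of_angle_succ {E : Type*} [NormedAddCommGroup E] [InnerProductSpace ℝ E] {m : ℕ}
    (v : Fin (m + 1) → E)
    (hstep : ∀ k (hk : k < m), angle (v ⟨k, by omega⟩) (v ⟨k + 1, by omega⟩) = Real.pi / m)
    (hv0 : ∀ i, v i ≠ 0)
    (hend : angle (v 0) (v (Fin.last m)) = Real.pi) {i j : Fin (m + 1)} (hij : i ≤ j) :
    angle (v i) (v j) = ((j : ℝ) - i) * (Real.pi / m) := by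
  have hle : ∀ d a (h : a + d < m + 1),
      angle (v ⟨a, by omega⟩) (v ⟨a + d, h⟩) ≤ d * (Real.pi / m) := by
    intro d
    induction d with
    | zero => intro a h; simp [angle_self (hv0 _)]
    | succ d ih =>
      intro a h
      have h1 := ih a (by omega)
      have h2 := hstep (a + d) (by omega)
      have h3 := angle_le_angle_add_angle (v ⟨a, by omega⟩) (v ⟨a + d, by omega⟩)
        (v ⟨a + (d + 1), h⟩)
      have h4 : (⟨a + d + 1, by omega⟩ : Fin (m + 1)) = ⟨a + (d + 1), h⟩ := rfl
      rw [h4] at h2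
      push_cast
      linarith
  have hle' : ∀ {a b : Fin (m + 1)}, a ≤ b →
      angle (v a) (v b) ≤ ((b : ℝ) - a) * (Real.pi / m) := by
    intro a b hab
    have hab' : (a : ℕ) ≤ b := hab
    have h := hle (b - a) a (by omega)
    rw [Nat.cast_sub hab'] at h
    convert h using 3
    exact Fin.ext (by simp; omega)
  have h1 := hle' (Fin.zero_le i)
  have h2 := hle' hij
  have h3 := hle' (Fin.le_last j)
  have h4 := angle_le_angle_add_angle (v 0) (v i) (v (Fin.last m))
  have h5 := angle_le_angle_add_angle (v i) (v j) (v (Fin.last m))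
  have hm : (m : ℝ) * (Real.pi / m) = Real.pi := by
    rcases Nat.eq_zero_or_pos m with rfl | hm
    · rw [show Fin.last 0 = 0 from rfl, angle_self (hv0 _)] at hend
      exact absurd hend Real.pi_pos.ne
    · exact mul_div_cancel₀ _ (by positivity)
  simp only [Fin.val_last, Fin.val_zero, Nat.cast_zero] at h1 h3
  refine le_antisymm h2 ?_
  rw [hend] at h4
  linarith

open scoped MatrixOrder in
/-- A positive semidefinite completion is the Gram matrix of unit vectors to which
`angle_eq_of_angle_succ` applies. -/
theorem psdCompletions_zero {m : ℕ} (hm : 2 ≤ m) :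
    psdCompletions (m + 1) {1, m} (cycleData (m + 1) 0) = {cosMatrix (m + 1)} := by
  refine Set.eq_singleton_iff_unique_mem.2
    ⟨⟨isCompletion_cosMatrix hm, posSemidef_cosMatrix m⟩, fun X hX => ?_⟩
  obtain ⟨⟨hsym, hX⟩, hpsd⟩ := hX
  obtain ⟨B, hB⟩ := CStarAlgebra.nonneg_iff_eq_star_mul_self.mp hpsd.nonneg
  set v : Fin (m + 1) → EuclideanSpace ℝ (Fin (m + 1)) := fun i => WithLp.toLp 2 (B.col i) with hv
  have hinner : ∀ i j, inner ℝ (v i) (v j) = X i j := by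
    intro i j
    rw [hB, hv, EuclideanSpace.inner_toLp_toLp, Matrix.mul_apply]
    simp [dotProduct, Matrix.star_apply, mul_comm]
  have hmpos : (0 : ℝ) < m := by positivity
  have hnorm : ∀ i, ‖v i‖ = 1 := by
    intro i
    rw [norm_eq_sqrt_real_inner, hinner, hX i i le_rfl (by simp)]
    simp [cycleData_zero]
  have hang : ∀ i j, InnerProductGeometry.angle (v i) (v j) = Real.arccos (X i j) := by
    intro i j
    rw [InnerProductGeometry.angle, hinner, hnorm, hnorm]
    simp
  have hpos : 0 ≤ Real.pi / m := by positivity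
  have hle : Real.pi / m ≤ Real.pi := div_le_self Real.pi_pos.le (by norm_cast; omega)
  have key : ∀ {i j : Fin (m + 1)}, i ≤ j → X i j = cosMatrix (m + 1) i j := by
    intro i j hij
    have h := angle_eq_of_angle_succ v (fun k hk => ?_) (fun i h0 => ?_) ?_ hij
    · rw [← hinner, ← InnerProductGeometry.cos_angle_mul_norm_mul_norm, hnorm, hnorm, h,
        cosMatrix_succ_apply, ← Real.cos_neg, ← neg_mul, neg_sub]
      ring
    · rw [hang, hX _ _ (by simp [Fin.le_def]) (by simp)]
      simp [cycleData_one, Real.arccos_cos hpos hle]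
    · have := hnorm i
      simp [h0] at this
    · rw [hang, hX _ _ (Fin.zero_le _) (by simp)]
      simp [cycleData_of_two_le _ _ hm]
  ext i j
  rcases le_total i j with h | h
  · exact key h
  · rw [← hsym.apply, ← isCompletion_cosMatrix hm |>.1.apply]
    exact key h

theorem rank_cosMatrix {m : ℕ} (hm : 2 ≤ m) : (cosMatrix (m + 1)).rank = 2 := by
  apply le_antisymm
  · obtain ⟨B, hB⟩ := cosMatrix_eq_mul_transpose m
    rw [hB]
    exact (Matrix.rank_mul_le_left B Bᵀ).trans B.rank_le_width
  · have hm0 : (0 : ℝ) < m := by positivity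
    have hsin : 0 < Real.sin (Real.pi / m) := by
      refine Real.sin_pos_of_pos_of_lt_pi (by positivity) ?_
      exact div_lt_self Real.pi_pos (by exact_mod_cast hm)
    set A := (cosMatrix (m + 1)).submatrix ![(0 : Fin (m + 1)), ⟨1, by omega⟩]
      ![(0 : Fin (m + 1)), ⟨1, by omega⟩] with hA
    have hdet : A.det ≠ 0 := by
      rw [Matrix.det_fin_two]
      simp only [hA, Matrix.submatrix_apply, cosMatrix_succ_apply, Matrix.cons_val_zero,
        Matrix.cons_val_one, Fin.val_zero, Nat.cast_zero, Nat.cast_one, sub_self, zero_mul,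
        Real.cos_zero, zero_sub, sub_zero, one_mul, neg_mul, Real.cos_neg]
      have := Real.sin_sq_add_cos_sq (Real.pi / m)
      nlinarith
    have h2 : A.rank = 2 := by
      simpa using Matrix.rank_of_isUnit A ((Matrix.isUnit_iff_isUnit_det A).2 hdet.isUnit)
    rw [← h2]
    exact Matrix.rank_submatrix_le _ _ _

/-! ### Symmetric matrices supported on the cycle -/

/-- `Z` is symmetric and vanishes off the main diagonal, the first off-diagonals and the two
corners. -/
def InCyclePattern (m : ℕ) (Z : Matrix (Fin (m + 1)) (Fin (m + 1)) ℝ) : Prop :=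
  Z.IsSymm ∧ ∀ i j : Fin (m + 1), i ≤ j → (j : ℕ) - (i : ℕ) ∉ insert 0 ({1, m} : Finset ℕ) →
    Z i j = 0

/-- The sum of the first and the last standard basis vector. -/
def endsVec (m : ℕ) : Fin (m + 1) → ℝ := Pi.single 0 1 + Pi.single (Fin.last m) 1

namespace InCyclePattern

variable {m : ℕ} {Z : Matrix (Fin (m + 1)) (Fin (m + 1)) ℝ}

theorem apply_eq_zero (hZ : InCyclePattern m Z) {i j : Fin (m + 1)} (h0 : (i : ℕ) ≠ j)
    (h1 : (i : ℕ) + 1 ≠ j) (h2 : (j : ℕ) + 1 ≠ i) (h3 : ¬ ((i : ℕ) = 0 ∧ (j : ℕ) = m))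
    (h4 : ¬ ((j : ℕ) = 0 ∧ (i : ℕ) = m)) : Z i j = 0 := by
  rcases le_total i j with h | h
  · have h' : (i : ℕ) ≤ j := h
    refine hZ.2 i j h ?_
    simp only [Finset.mem_insert, Finset.mem_singleton]
    omega
  · have h' : (j : ℕ) ≤ i := h
    rw [← hZ.1.apply]
    refine hZ.2 j i h ?_
    simp only [Finset.mem_insert, Finset.mem_singleton]
    omega

theorem mulVec_apply_zero (hZ : InCyclePattern m Z) (hm : 2 ≤ m) (f : Fin (m + 1) → ℝ) :
    (Z *ᵥ f) 0 = Z 0 0 * f 0 + Z 0 ⟨1, by omega⟩ * f ⟨1, by omega⟩ +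
      Z 0 (Fin.last m) * f (Fin.last m) := by
  rw [Matrix.mulVec, dotProduct, ← Finset.sum_subset
    (Finset.subset_univ {(0 : Fin (m + 1)), ⟨1, by omega⟩, Fin.last m})]
  · rw [Finset.sum_insert, Finset.sum_pair, add_assoc]
    · simp [Fin.ext_iff]; omega
    · simp [Fin.ext_iff]; omega
  · intro j _ hj
    simp only [Finset.mem_insert, Finset.mem_singleton, Fin.ext_iff, Fin.val_zero,
      Fin.val_last] at hj
    rw [hZ.apply_eq_zero, zero_mul] <;> simp only [Fin.val_zero] <;> omega

theorem mulVec_apply_succ (hZ : InCyclePattern m Z) {k : ℕ} (hk : k + 2 ≤ m)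
    (f : Fin (m + 1) → ℝ) :
    (Z *ᵥ f) ⟨k + 1, by omega⟩ =
      Z ⟨k + 1, by omega⟩ ⟨k, by omega⟩ * f ⟨k, by omega⟩ +
      Z ⟨k + 1, by omega⟩ ⟨k + 1, by omega⟩ * f ⟨k + 1, by omega⟩ +
      Z ⟨k + 1, by omega⟩ ⟨k + 2, by omega⟩ * f ⟨k + 2, by omega⟩ := by
  rw [Matrix.mulVec, dotProduct, ← Finset.sum_subset
    (Finset.subset_univ {(⟨k, by omega⟩ : Fin (m + 1)), ⟨k + 1, by omega⟩, ⟨k + 2, by omega⟩})]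
  · rw [Finset.sum_insert, Finset.sum_pair, add_assoc]
    · simp [Fin.ext_iff]
    · simp [Fin.ext_iff]
  · intro j _ hj
    simp only [Finset.mem_insert, Finset.mem_singleton, Fin.ext_iff] at hj
    rw [hZ.apply_eq_zero, zero_mul] <;> simp only <;> omega

theorem mulVec_apply_last (hZ : InCyclePattern m Z) (hm : 2 ≤ m) (f : Fin (m + 1) → ℝ) :
    (Z *ᵥ f) (Fin.last m) = Z (Fin.last m) 0 * f 0 +
      Z (Fin.last m) ⟨m - 1, by omega⟩ * f ⟨m - 1, by omega⟩ +
      Z (Fin.last m) (Fin.last m) * f (Fin.last m) := by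
  rw [Matrix.mulVec, dotProduct, ← Finset.sum_subset
    (Finset.subset_univ {(0 : Fin (m + 1)), ⟨m - 1, by omega⟩, Fin.last m})]
  · rw [Finset.sum_insert, Finset.sum_pair, add_assoc]
    · simp [Fin.ext_iff]; omega
    · simp [Fin.ext_iff]; omega
  · intro j _ hj
    simp only [Finset.mem_insert, Finset.mem_singleton, Fin.ext_iff, Fin.val_zero,
      Fin.val_last] at hj
    rw [hZ.apply_eq_zero, zero_mul] <;> simp only [Fin.val_last] <;> omega

/-- The matrices of the pattern are orthogonal to the differences of completions. -/
theorem trace_mul_eq {t : ℕ → ℝ} {X Y : Matrix (Fin (m + 1)) (Fin (m + 1)) ℝ}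
    (hZ : InCyclePattern m Z) (hX : IsCompletion (m + 1) {1, m} t X)
    (hY : IsCompletion (m + 1) {1, m} t Y) : (Z * X).trace = (Z * Y).trace := by
  simp only [Matrix.trace, Matrix.diag_apply, Matrix.mul_apply]
  refine Finset.sum_congr rfl fun i _ => Finset.sum_congr rfl fun j _ => ?_
  by_cases h : Z i j = 0
  · rw [h, zero_mul, zero_mul]
  · congr 1
    rcases le_total i j with hij | hij
    · have hp : (j : ℕ) - (i : ℕ) ∈ insert 0 ({1, m} : Finset ℕ) := by
        by_contra hp
        exact h (hZ.2 i j hij hp)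
      rw [← hX.1.apply, ← hY.1.apply, hX.2 i j hij hp, hY.2 i j hij hp]
    · have hp : (i : ℕ) - (j : ℕ) ∈ insert 0 ({1, m} : Finset ℕ) := by
        by_contra hp
        exact h (by rw [← hZ.1.apply, hZ.2 j i hij hp])
      rw [hX.2 j i hij hp, hY.2 j i hij hp]

end InCyclePattern

/-! ### Exposing vectors and the singularity degree -/

theorem inCyclePattern_of_inAdjointRange {m : ℕ} {t : ℕ → ℝ}
    {Z : Matrix (Fin (m + 1)) (Fin (m + 1)) ℝ}
    (hZ : (completionSDP (m + 1) {1, m} t).InAdjointRange Z) : InCyclePattern m Z := by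
  obtain ⟨y, rfl⟩ := hZ
  constructor
  · rw [Matrix.IsSymm, Matrix.transpose_sum]
    refine Finset.sum_congr rfl fun p _ => ?_
    rw [Matrix.transpose_smul, (completionSDP (m + 1) {1, m} t).constraint_symm p]
  · intro i j hij h
    rw [Matrix.sum_apply]
    refine Finset.sum_eq_zero fun p _ => ?_
    obtain ⟨⟨k, l⟩, hkl, hp⟩ := p
    simp only [completionSDP, Matrix.smul_apply, Matrix.add_apply, Matrix.single_apply]
    have h1 : ¬ (k = i ∧ l = j) := by
      rintro ⟨rfl, rfl⟩
      exact h hp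
    have h2 : ¬ (l = i ∧ k = j) := by
      rintro ⟨rfl, rfl⟩
      obtain rfl := le_antisymm hij hkl
      exact h hp
    simp [h1, h2]

theorem vecMulVec_endsVec (m : ℕ) : Matrix.vecMulVec (endsVec m) (endsVec m) =
    Matrix.single 0 0 1 + Matrix.single (Fin.last m) (Fin.last m) 1 +
      (Matrix.single 0 (Fin.last m) 1 + Matrix.single (Fin.last m) 0 1) := by
  simp only [endsVec, Matrix.add_vecMulVec, Matrix.vecMulVec_add,
    ← Matrix.single_eq_single_vecMulVec_single]
  abel

theorem inAdjointRange_smul_endsVec (m : ℕ) (t : ℕ → ℝ) (a : ℝ) :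
    (completionSDP (m + 1) {1, m} t).InAdjointRange
      (a • Matrix.vecMulVec (endsVec m) (endsVec m)) := by
  let p : Specified (m + 1) {1, m} := ⟨(0, 0), by simp⟩
  let q : Specified (m + 1) {1, m} := ⟨(Fin.last m, Fin.last m), by simp⟩
  let r : Specified (m + 1) {1, m} := ⟨(0, Fin.last m), by simp⟩
  refine ⟨Pi.single p a + Pi.single q a + Pi.single r (2 * a), ?_⟩
  simp only [Pi.add_apply, add_smul, Finset.sum_add_distrib, Pi.single_apply, ite_smul, zero_smul,
    Finset.sum_ite_eq', Finset.mem_univ, if_true]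
  rw [vecMulVec_endsVec]
  simp only [completionSDP, p, q, r]
  module

theorem cosMatrix_mulVec_endsVec {m : ℕ} (hm : 1 ≤ m) : cosMatrix (m + 1) *ᵥ endsVec m = 0 := by
  have hm0 : (m : ℝ) ≠ 0 := by positivity
  funext i
  simp [endsVec, Matrix.mulVec_add, cosMatrix_succ_apply, sub_mul, mul_div_cancel₀ _ hm0,
    Real.cos_sub_pi]

/-- The kernel condition in row `0` involves the columns `0, 1, m`, the last of which is opposite to
the first; hence `Z 0 1 = 0`. Row after row, all off-diagonal entries except the corners vanish. -/
theorem InCyclePattern.eq_smul_of_mul_cosMatrix_eq_zero {m : ℕ} (hm : 2 ≤ m)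
    {Z : Matrix (Fin (m + 1)) (Fin (m + 1)) ℝ} (hZ : InCyclePattern m Z)
    (hmul : Z * cosMatrix (m + 1) = 0) :
    Z = Z 0 0 • Matrix.vecMulVec (endsVec m) (endsVec m) := by
  have hm0 : (0 : ℝ) < m := by positivity
  set θ := Real.pi / m with hθ
  have hmθ : (m : ℝ) * θ = Real.pi := mul_div_cancel₀ _ hm0.ne'
  have hsin : 0 < Real.sin θ := by
    refine Real.sin_pos_of_pos_of_lt_pi (by positivity) ?_
    exact div_lt_self Real.pi_pos (by exact_mod_cast hm)
  have hcos : Real.cos θ ^ 2 < 1 := by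
    have := Real.sin_sq_add_cos_sq θ
    nlinarith
  -- two consecutive rows of `cosMatrix` are linearly independent
  have hind : ∀ x y : ℝ, x + y * Real.cos θ = 0 → x * Real.cos θ + y = 0 → x = 0 ∧ y = 0 := by
    intro x y h1 h2
    have hx : x * (1 - Real.cos θ ^ 2) = 0 := by linear_combination h1 - Real.cos θ * h2
    have hy : y * (1 - Real.cos θ ^ 2) = 0 := by linear_combination h2 - Real.cos θ * h1
    exact ⟨(mul_eq_zero.1 hx).resolve_right (by linarith),
      (mul_eq_zero.1 hy).resolve_right (by linarith)⟩
  have hmv : ∀ i k, (Z *ᵥ (cosMatrix (m + 1)).col k) i = 0 := fun i k => congrFun₂ hmul i k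
  have hr0 : Z 0 0 - Z 0 (Fin.last m) = 0 ∧ Z 0 ⟨1, by omega⟩ = 0 := by
    have h0 := hmv 0 0
    have h1 := hmv 0 ⟨1, by omega⟩
    rw [hZ.mulVec_apply_zero hm] at h0 h1
    simp only [Matrix.col_apply, cosMatrix_succ_apply, ← hθ, Fin.val_zero, Fin.val_last, sub_mul,
      hmθ, Real.cos_pi_sub, Nat.cast_zero, Nat.cast_one, zero_mul, one_mul, sub_self, sub_zero,
      zero_sub, Real.cos_zero, neg_mul, Real.cos_neg, Real.cos_pi] at h0 h1
    exact hind _ _ (by linear_combination h0) (by linear_combination h1)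
  have hsucc : ∀ k (hk : k + 1 ≤ m), Z ⟨k, by omega⟩ ⟨k + 1, by omega⟩ = 0 ∧
      (0 < k → Z ⟨k, by omega⟩ ⟨k, by omega⟩ = 0) := by
    intro k
    induction k with
    | zero => exact fun _ => ⟨hr0.2, fun h => absurd h (lt_irrefl 0)⟩
    | succ k ih =>
      intro hk
      have hprev : Z ⟨k + 1, by omega⟩ ⟨k, by omega⟩ = 0 := by
        rw [← hZ.1.apply]
        exact (ih (by omega)).1
      have h0 := hmv ⟨k + 1, by omega⟩ ⟨k + 1, by omega⟩
      have h1 := hmv ⟨k + 1, by omega⟩ ⟨k + 2, by omega⟩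
      rw [hZ.mulVec_apply_succ (by omega), hprev] at h0 h1
      simp only [Matrix.col_apply, cosMatrix_succ_apply, ← hθ] at h0 h1
      push_cast at h0 h1
      have e1 : (k : ℝ) + 2 - (k + 1) = 1 := by ring
      have e2 : (k : ℝ) + 1 - (k + 2) = -1 := by ring
      rw [e1] at h0
      rw [e2] at h1
      simp only [sub_self, zero_mul, one_mul, neg_mul, Real.cos_zero, Real.cos_neg, mul_one,
        zero_add] at h0 h1
      have h := hind _ _ h0 h1
      exact ⟨h.2, fun _ => h.1⟩
  have hlast : Z (Fin.last m) (Fin.last m) = Z 0 (Fin.last m) := by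
    have h0 := hmv (Fin.last m) 0
    have hprev : Z (Fin.last m) ⟨m - 1, by omega⟩ = 0 := by
      rw [← hZ.1.apply]
      obtain ⟨k, rfl⟩ : ∃ k, m = k + 1 := ⟨m - 1, by omega⟩
      exact (hsucc k le_rfl).1
    rw [hZ.mulVec_apply_last hm, hprev, hZ.1.apply 0 (Fin.last m)] at h0
    simp only [Matrix.col_apply, cosMatrix_succ_apply, ← hθ, Fin.val_zero, Fin.val_last,
      hmθ, Nat.cast_zero, zero_mul, sub_self, sub_zero, Real.cos_zero, Real.cos_pi] at h0
    linear_combination -h0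
  have hends : ∀ i : Fin (m + 1), endsVec m i = if (i : ℕ) = 0 ∨ (i : ℕ) = m then 1 else 0 := by
    intro i
    simp only [endsVec, Pi.add_apply, Pi.single_apply, Fin.ext_iff, Fin.val_zero, Fin.val_last]
    by_cases h0 : (i : ℕ) = 0 <;> by_cases hm' : (i : ℕ) = m <;> simp [h0, hm']
    all_goals omega
  have hle : ∀ i j : Fin (m + 1), i ≤ j → Z i j = Z 0 0 * (endsVec m i * endsVec m j) := by
    rintro ⟨i, hi⟩ ⟨j, hj⟩ hij
    have hij' : i ≤ j := hij
    rw [hends, hends]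
    simp only
    rcases eq_or_ne i j with rfl | hne
    · rcases Nat.eq_zero_or_pos i with rfl | hpos
      · simp
      · rcases eq_or_ne i m with rfl | him
        · simp only [or_true, if_true, mul_one]
          exact hlast.trans (by linarith [hr0.1])
        · rw [if_neg (by omega), mul_zero, mul_zero]
          exact (hsucc i (by omega)).2 hpos
    · by_cases hcorner : i = 0 ∧ j = m
      · obtain ⟨rfl, rfl⟩ := hcorner
        simp only [true_or, or_true, if_true, mul_one]
        exact (sub_eq_zero.1 hr0.1).symm
      · have h0 : (if i = 0 ∨ i = m then (1 : ℝ) else 0) * (if j = 0 ∨ j = m then 1 else 0) = 0 := by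
          by_cases h : i = 0
          · rw [if_neg (by omega : ¬ (j = 0 ∨ j = m)), mul_zero]
          · rw [if_neg (by omega : ¬ (i = 0 ∨ i = m)), zero_mul]
        rw [h0, mul_zero]
        rcases eq_or_ne (i + 1) j with rfl | hne1
        · exact (hsucc i (by omega)).1
        · exact hZ.apply_eq_zero hne hne1 (by simp only; omega) hcorner (by simp only; omega)
  ext i j
  rw [Matrix.smul_apply, Matrix.vecMulVec_apply, smul_eq_mul]
  rcases le_total i j with h | h
  · exact hle i j h
  · rw [← hZ.1.apply, hle j i h, mul_comm (endsVec m j)]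

theorem not_slater_completionSDP {m : ℕ} (hm : 2 ≤ m) :
    ¬ (completionSDP (m + 1) {1, m} (cycleData (m + 1) 0)).Slater := by
  rintro ⟨X, hX, hpos⟩
  rw [feasible_completionSDP, psdCompletions_zero hm] at hX
  obtain rfl : X = cosMatrix (m + 1) := hX
  have h := rank_cosMatrix hm
  rw [Matrix.rank_of_isUnit _ hpos.isUnit, Fintype.card_fin] at h
  omega

theorem feasible_restrict {J ι κ : Type} [Fintype ι] [Fintype κ] (S : SDP J ι)
    (V : Matrix ι κ ℝ) {R : Matrix κ κ ℝ} (hR : R ∈ (S.restrict V).feasible) :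
    V * R * Vᵀ ∈ S.feasible := by
  refine ⟨?_, fun j => ?_⟩
  · simpa using hR.1.mul_mul_conjTranspose_same V
  · refine Eq.trans ?_ (hR.2 j)
    simp only [SDP.restrict, Matrix.mul_assoc]
    rw [Matrix.trace_mul_comm Vᵀ]
    simp only [Matrix.mul_assoc]

theorem slater_of_regularizedIn_zero {J : Type} [Fintype J] {r : ℕ} {S : SDP J (Fin r)}
    (h : S.RegularizedIn 0) : S.Slater := by
  cases h with
  | zero _ h => exact h

theorem exists_of_regularizedIn_one {J : Type} [Fintype J] {r : ℕ} {S : SDP J (Fin r)}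
    (h : S.RegularizedIn 1) : ∃ (s : ℕ) (Z : Matrix (Fin r) (Fin r) ℝ)
      (V : Matrix (Fin r) (Fin s) ℝ), S.IsExposingVector Z ∧ Function.Injective V.mulVec ∧
      LinearMap.range V.mulVecLin = LinearMap.ker Z.mulVecLin ∧ (S.restrict V).Slater := by
  cases h with
  | succ _ Z V hZ _ hinj hker h =>
    exact ⟨_, Z, V, hZ, hinj, hker, slater_of_regularizedIn_zero h⟩

/-- After a single facial reduction step the feasible set is still the rank two matrix `cosMatrix`,
so the Slater condition would force an exposing vector of rank `m - 1`; but exposing vectors have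
rank one. -/
theorem two_le_singularityDegree {m : ℕ} (hm : 3 ≤ m) :
    2 ≤ (completionSDP (m + 1) {1, m} (cycleData (m + 1) 0)).singularityDegree := by
  refine le_iInf₂ fun k hk => ?_
  by_contra! hlt
  have hlt' : k < 2 := by exact_mod_cast hlt
  interval_cases k
  · exact not_slater_completionSDP (by omega) (slater_of_regularizedIn_zero hk)
  obtain ⟨s, Z, V, hZ, hinj, hker, R, hR, hRpos⟩ := exists_of_regularizedIn_one hk
  have hmem := feasible_restrict _ V hR
  have hZrank : Z.rank ≤ 1 := by
    have hfeas : cosMatrix (m + 1) ∈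
        (completionSDP (m + 1) {1, m} (cycleData (m + 1) 0)).feasible := by
      rw [feasible_completionSDP, psdCompletions_zero (by omega)]
      rfl
    rw [(inCyclePattern_of_inAdjointRange hZ.2.2.1).eq_smul_of_mul_cosMatrix_eq_zero (by omega)
      (hZ.2.2.2 _ hfeas), ← Matrix.smul_vecMulVec]
    exact Matrix.rank_vecMulVec_le _ _
  rw [feasible_completionSDP, psdCompletions_zero (by omega)] at hmem
  have hVrank : V.rank = s := by
    rw [Matrix.rank, LinearMap.finrank_range_of_inj hinj, Module.finrank_fin_fun]
  have hs : s ≤ 2 := by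
    have hG : IsUnit (Vᵀ * V) := by
      simpa using (Matrix.PosDef.conjTranspose_mul_self V hinj).isUnit
    have h := Matrix.rank_of_isUnit _ ((hG.mul hRpos.isUnit).mul hG)
    rw [Fintype.card_fin, show Vᵀ * V * R * (Vᵀ * V) = Vᵀ * (V * R * Vᵀ * V) by
      simp only [Matrix.mul_assoc], show V * R * Vᵀ = cosMatrix (m + 1) from hmem] at h
    rw [← h, ← rank_cosMatrix (m := m) (by omega)]
    exact (Matrix.rank_mul_le_right _ _).trans (Matrix.rank_mul_le_left _ _)
  have hdim := LinearMap.finrank_range_add_finrank_ker Z.mulVecLin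
  rw [← hker, Module.finrank_fin_fun] at hdim
  change Z.rank + V.rank = m + 1 at hdim
  omega

/-! ### Toeplitz matrices with inverse supported on the cycle -/

/-- The symmetric matrix with corner entries `d`, first off-diagonals `c`, and main diagonal
`a, b, …, b, a`. -/
def cycleMatrix (m : ℕ) (a b c d : ℝ) : Matrix (Fin (m + 1)) (Fin (m + 1)) ℝ :=
  Matrix.of fun i j =>
    if (i : ℕ) = j then (if (i : ℕ) = 0 ∨ (i : ℕ) = m then a else b)
    else if (i : ℕ) + 1 = j ∨ (j : ℕ) + 1 = i then c
    else if ((i : ℕ) = 0 ∧ (j : ℕ) = m) ∨ ((j : ℕ) = 0 ∧ (i : ℕ) = m) then d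
    else 0

/-- The symmetric Toeplitz matrix with entries `x |i - j|`. -/
def toeplitzMatrix (m : ℕ) (x : ℝ → ℝ) : Matrix (Fin (m + 1)) (Fin (m + 1)) ℝ :=
  Matrix.of fun i j => x |(i : ℝ) - (j : ℝ)|

theorem inCyclePattern_cycleMatrix (m : ℕ) (a b c d : ℝ) :
    InCyclePattern m (cycleMatrix m a b c d) := by
  constructor
  · ext i j
    simp only [cycleMatrix, Matrix.transpose_apply, Matrix.of_apply]
    split_ifs <;> first | rfl | omega
  · intro i j hij h
    have hij' : (i : ℕ) ≤ j := hij
    simp only [Finset.mem_insert, Finset.mem_singleton] at h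
    simp only [cycleMatrix, Matrix.of_apply]
    rw [if_neg (by omega), if_neg (by omega), if_neg (by omega)]

section cycleMatrix

variable {m : ℕ} {a b c d : ℝ}

theorem cycleMatrix_mulVec_zero (hm : 2 ≤ m) (f : Fin (m + 1) → ℝ) :
    (cycleMatrix m a b c d *ᵥ f) 0 = a * f 0 + c * f ⟨1, by omega⟩ + d * f (Fin.last m) := by
  rw [(inCyclePattern_cycleMatrix m a b c d).mulVec_apply_zero hm]
  simp [cycleMatrix, show (0 : ℕ) ≠ m by omega, show 1 ≠ m by omega]

theorem cycleMatrix_mulVec_succ {k : ℕ} (hk : k + 2 ≤ m) (f : Fin (m + 1) → ℝ) :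
    (cycleMatrix m a b c d *ᵥ f) ⟨k + 1, by omega⟩ =
      c * f ⟨k, by omega⟩ + b * f ⟨k + 1, by omega⟩ + c * f ⟨k + 2, by omega⟩ := by
  rw [(inCyclePattern_cycleMatrix m a b c d).mulVec_apply_succ hk]
  simp [cycleMatrix, show k + 1 ≠ m by omega]

theorem cycleMatrix_mulVec_last (hm : 2 ≤ m) (f : Fin (m + 1) → ℝ) :
    (cycleMatrix m a b c d *ᵥ f) (Fin.last m) =
      d * f 0 + c * f ⟨m - 1, by omega⟩ + a * f (Fin.last m) := by
  rw [(inCyclePattern_cycleMatrix m a b c d).mulVec_apply_last hm]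
  simp [cycleMatrix, show m ≠ 0 by omega, show m ≠ m - 1 by omega, show m - 1 + 1 = m by omega,
    show 1 ≠ m by omega]

/-- If `x` solves a second order recursion, then the interior rows of the product vanish off the
diagonal. The relation `hrow` deals with the first row and, after reversal, with the last one. -/
theorem cycleMatrix_mul_toeplitzMatrix (hm : 2 ≤ m) {x : ℝ → ℝ}
    (hrec : ∀ t, c * x (t - 1) + b * x t + c * x (t + 1) = 0)
    (hrow : ∀ t, a * x t + c * x (t - 1) + d * x (m - t) = 0)
    (hjump : c * (x 1 - x (-1)) = 1) :
    cycleMatrix m a b c d * toeplitzMatrix m x = 1 := by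
  have hx : ∀ i j, (toeplitzMatrix m x).col j i = x |(i : ℝ) - (j : ℝ)| := fun i j => rfl
  ext i j
  change (cycleMatrix m a b c d *ᵥ (toeplitzMatrix m x).col j) i = _
  have hjm : (j : ℕ) ≤ m := by omega
  have hjm' : (j : ℝ) ≤ m := by exact_mod_cast hjm
  obtain ⟨i, hi⟩ := i
  rcases Nat.eq_zero_or_pos i with rfl | hi0
  · rw [show (⟨0, hi⟩ : Fin (m + 1)) = 0 from rfl, cycleMatrix_mulVec_zero hm]
    simp only [hx, Fin.val_zero, Fin.val_last, Nat.cast_zero, Nat.cast_one, zero_sub, abs_neg,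
      Nat.abs_cast, abs_of_nonneg (sub_nonneg.2 hjm')]
    rcases eq_or_ne j 0 with rfl | hj
    · have := hrow 0
      simp only [zero_sub, sub_zero] at this
      simp only [Fin.val_zero, Nat.cast_zero, sub_zero, abs_one, Matrix.one_apply_eq]
      linear_combination this + hjump
    · have hj1 : (1 : ℝ) ≤ j := by
        have : (j : ℕ) ≠ 0 := fun h => hj (Fin.ext h)
        exact_mod_cast Nat.one_le_iff_ne_zero.2 this
      rw [Matrix.one_apply_ne hj.symm, abs_sub_comm, abs_of_nonneg (sub_nonneg.2 hj1)]
      exact hrow j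
  rcases eq_or_ne i m with rfl | him
  · rw [show (⟨i, hi⟩ : Fin (i + 1)) = Fin.last i from rfl, cycleMatrix_mulVec_last hm]
    simp only [hx, Fin.val_zero, Fin.val_last, Nat.cast_zero, zero_sub, abs_neg,
      Nat.abs_cast, abs_of_nonneg (sub_nonneg.2 hjm'), Nat.cast_sub (by omega : 1 ≤ i),
      Nat.cast_one]
    rcases eq_or_ne (Fin.last i) j with rfl | hj
    · have := hrow 0
      simp only [zero_sub, sub_zero] at this
      simp only [Fin.val_last, sub_self, Matrix.one_apply_eq, sub_sub_cancel_left, abs_neg, abs_one]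
      linear_combination this + hjump
    · have hj1 : (j : ℝ) + 1 ≤ i := by
        have : (j : ℕ) ≠ i := fun h => hj (Fin.ext (by simp [h]))
        exact_mod_cast (by omega : (j : ℕ) + 1 ≤ i)
      rw [Matrix.one_apply_ne hj, abs_of_nonneg (by linarith)]
      have := hrow (i - j)
      rw [sub_sub_cancel, sub_right_comm] at this
      linear_combination this
  · obtain ⟨k, rfl⟩ : ∃ k, i = k + 1 := ⟨i - 1, by omega⟩
    rw [cycleMatrix_mulVec_succ (by omega)]
    simp only [hx]
    push_cast
    rcases lt_trichotomy (j : ℕ) (k + 1) with h | h | h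
    · have h' : (j : ℝ) ≤ k := by exact_mod_cast (by omega : (j : ℕ) ≤ k)
      rw [Matrix.one_apply_ne (by rintro rfl; simp at h), abs_of_nonneg (by linarith),
        abs_of_nonneg (by linarith), abs_of_nonneg (by linarith)]
      have := hrec (k + 1 - j)
      rw [show (k : ℝ) + 1 - j - 1 = k - j by ring, show (k : ℝ) + 1 - j + 1 = k + 2 - j by ring]
        at this
      exact this
    · obtain rfl : j = ⟨k + 1, by omega⟩ := Fin.ext h
      have := hrec 0
      simp only [zero_sub, zero_add] at this
      rw [Matrix.one_apply_eq]
      push_cast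
      rw [show (k : ℝ) - (k + 1) = -1 by ring, show (k : ℝ) + 2 - (k + 1) = 1 by ring, sub_self,
        abs_neg, abs_one, abs_zero]
      linear_combination this + hjump
    · have h' : (k : ℝ) + 2 ≤ j := by exact_mod_cast (by omega : k + 2 ≤ (j : ℕ))
      rw [Matrix.one_apply_ne (by rintro rfl; simp at h), abs_of_nonpos (by linarith),
        abs_of_nonpos (by linarith), abs_of_nonpos (by linarith)]
      have := hrec (-(k + 1 - j))
      rw [show -((k : ℝ) + 1 - j) - 1 = -(k + 2 - j) by ring,
        show -((k : ℝ) + 1 - j) + 1 = -(k - j) by ring] at this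
      linear_combination this

/-- The discrete Picone inequality, with comparison function `h`: partial sums of the quadratic form
of the tridiagonal matrix with rows `-1, 2 C, -1`. -/
theorem le_sum_tridiagonal {h F : ℕ → ℝ} {C : ℝ} {N : ℕ} (h0 : h 0 = 0)
    (hpos : ∀ k, k < N → 0 < h (k + 1))
    (hrec : ∀ k, h k + h (k + 2) = 2 * C * h (k + 1)) (hF : F 0 = 0) :
    ∀ K, K < N → F K * F (K + 1) - h K / h (K + 1) * F (K + 1) ^ 2 ≤
      ∑ k ∈ Finset.range K, F (k + 1) * (2 * C * F (k + 1) - F k - F (k + 2)) := by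
  intro K
  induction K with
  | zero => simp [h0, hF]
  | succ K ih =>
    intro hK
    have h1 := hpos K (by omega)
    have h2 := hpos (K + 1) hK
    have hih := ih (by omega)
    rw [Finset.sum_range_succ]
    have hC : 2 * C = h K / h (K + 1) + h (K + 1 + 1) / h (K + 1) := by
      rw [← add_div, hrec K]
      field_simp
    have hsq : 0 ≤ h (K + 1 + 1) / h (K + 1) * F (K + 1) ^ 2 - 2 * F (K + 1) * F (K + 1 + 1) +
        h (K + 1) / h (K + 1 + 1) * F (K + 1 + 1) ^ 2 := by
      have : h (K + 1 + 1) / h (K + 1) * F (K + 1) ^ 2 - 2 * F (K + 1) * F (K + 1 + 1) +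
          h (K + 1) / h (K + 1 + 1) * F (K + 1 + 1) ^ 2 =
          (h (K + 1 + 1) * F (K + 1) - h (K + 1) * F (K + 1 + 1)) ^ 2 /
            (h (K + 1) * h (K + 1 + 1)) := by
        field_simp
        ring
      rw [this]
      positivity
    rw [show K + 2 = K + 1 + 1 from rfl]
    linear_combination hih + hsq - F (K + 1) ^ 2 * hC

/-- The interior block of `cycleMatrix` is `-c` times the tridiagonal matrix with rows
`-1, 2 cos φ, -1`. It is compared with the sequence `sin (k φ)`, which stays positive for
`1 ≤ k ≤ m` because `m φ < π`. -/
theorem dotProduct_cycleMatrix_mulVec_nonneg (hm : 2 ≤ m) {φ : ℝ} (hφ : 0 < φ)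
    (hφm : m * φ < Real.pi) (hc : c ≤ 0) (hb : b = -2 * c * Real.cos φ) {r : Fin (m + 1) → ℝ}
    (hr0 : r 0 = 0) (hrm : r (Fin.last m) = 0) :
    0 ≤ r ⬝ᵥ cycleMatrix m a b c d *ᵥ r := by
  set F : ℕ → ℝ := fun k => if h : k < m + 1 then r ⟨k, h⟩ else 0 with hF
  have hFr : ∀ k (h : k < m + 1), r ⟨k, h⟩ = F k := fun k h => by
    simp only [hF, dif_pos h]
  have hF0 : F 0 = 0 := by rw [← hFr 0 (by omega)]; exact hr0
  have hFm : F m = 0 := by rw [← hFr m (by omega)]; exact hrm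
  have hsum : r ⬝ᵥ cycleMatrix m a b c d *ᵥ r = -c * ∑ k ∈ Finset.range (m - 1),
      F (k + 1) * (2 * Real.cos φ * F (k + 1) - F k - F (k + 2)) := by
    obtain ⟨p, rfl⟩ : ∃ p, m = p + 1 := ⟨m - 1, by omega⟩
    rw [dotProduct, Fin.sum_univ_castSucc, Fin.sum_univ_succ, hrm, Fin.castSucc_zero, hr0, zero_mul,
      zero_mul, add_zero, zero_add, Finset.mul_sum, Nat.add_sub_cancel, Finset.sum_range]
    refine Finset.sum_congr rfl fun k _ => ?_
    have hk : k.succ.castSucc = (⟨k + 1, by omega⟩ : Fin (p + 1 + 1)) := rfl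
    rw [hk, cycleMatrix_mulVec_succ (by omega), hFr, hFr, hFr, hb]
    ring
  have hsin : ∀ k, k < m → 0 < Real.sin (((k + 1 : ℕ) : ℝ) * φ) := by
    intro k hk
    refine Real.sin_pos_of_pos_of_lt_pi (by positivity) (lt_of_le_of_lt ?_ hφm)
    exact mul_le_mul_of_nonneg_right (by exact_mod_cast hk) hφ.le
  have h := le_sum_tridiagonal (h := fun k => Real.sin ((k : ℝ) * φ)) (F := F)
    (C := Real.cos φ) (by simp) hsin (fun k => ?_) hF0 (m - 1) (by omega)
  · rw [show m - 1 + 1 = m by omega, hFm] at h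
    rw [hsum]
    refine mul_nonneg (by linarith) (le_trans ?_ h)
    simp
  · push_cast
    have e1 : (k : ℝ) * φ = (k + 1) * φ - φ := by ring
    have e2 : ((k : ℝ) + 2) * φ = (k + 1) * φ + φ := by ring
    rw [e1, e2, Real.sin_sub, Real.sin_add]
    ring

end cycleMatrix

/-- The argument is a block elimination: the principal submatrix of `X` at the two ends is the
inverse of the Schur complement of the interior block of `M = X⁻¹`. -/
theorem posDef_of_mul_eq_one_of_ends {m : ℕ} {M X : Matrix (Fin (m + 1)) (Fin (m + 1)) ℝ}
    (hM : M.IsSymm) (hMX : M * X = 1) {s : ℝ} (hs : 1 < s) (h00 : X 0 0 = s)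
    (h0m : X 0 (Fin.last m) = -1) (hm0 : X (Fin.last m) 0 = -1)
    (hmm : X (Fin.last m) (Fin.last m) = s)
    (hint : ∀ r : Fin (m + 1) → ℝ, r 0 = 0 → r (Fin.last m) = 0 → 0 ≤ r ⬝ᵥ M *ᵥ r) :
    X.PosDef := by
  have hs2 : s ^ 2 - 1 ≠ 0 := by nlinarith
  have hpsd : M.PosSemidef := by
    refine .of_dotProduct_mulVec_nonneg (by simpa using hM) fun v => ?_
    rw [star_trivial]
    -- `w = X e`, with `e` supported on the ends, agrees with `v` there, and `M w = e`
    set y : ℝ := (s * v 0 + v (Fin.last m)) / (s ^ 2 - 1) with hy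
    set z : ℝ := (v 0 + s * v (Fin.last m)) / (s ^ 2 - 1) with hz
    set e : Fin (m + 1) → ℝ := y • Pi.single 0 1 + z • Pi.single (Fin.last m) 1 with he
    set w := X *ᵥ e with hw
    have hMw : M *ᵥ w = e := by rw [hw, Matrix.mulVec_mulVec, hMX, Matrix.one_mulVec]
    have hwi : ∀ i, w i = y * X i 0 + z * X i (Fin.last m) := by
      intro i
      rw [hw, he, Matrix.mulVec_add, Matrix.mulVec_smul, Matrix.mulVec_smul,
        Matrix.mulVec_single_one, Matrix.mulVec_single_one]
      rfl
    have hw0 : w 0 = v 0 := by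
      rw [hwi, h00, h0m, hy, hz]
      field_simp
      ring
    have hwm : w (Fin.last m) = v (Fin.last m) := by
      rw [hwi, hm0, hmm, hy, hz]
      field_simp
      ring
    have hdot : ∀ u : Fin (m + 1) → ℝ, u ⬝ᵥ e = y * u 0 + z * u (Fin.last m) := by
      intro u
      simp [he, dotProduct_add, dotProduct_smul]
    have hr := hint (v - w) (by simp [hw0]) (by simp [hwm])
    have hcross : (v - w) ⬝ᵥ M *ᵥ w = 0 := by
      rw [hMw, hdot]
      simp [hw0, hwm]
    have hcross' : w ⬝ᵥ M *ᵥ (v - w) = 0 := by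
      rw [Matrix.dotProduct_mulVec, ← Matrix.mulVec_transpose, hM, dotProduct_comm]
      exact hcross
    have hww : 0 ≤ w ⬝ᵥ M *ᵥ w := by
      rw [hMw, hdot, hwi, hwi, h00, h0m, hm0, hmm]
      nlinarith [sq_nonneg (y - z), mul_nonneg (sub_nonneg.2 hs.le) (sq_nonneg y),
        mul_nonneg (sub_nonneg.2 hs.le) (sq_nonneg z)]
    have hv : v = (v - w) + w := by simp
    rw [hv, Matrix.mulVec_add, dotProduct_add, add_dotProduct, add_dotProduct, hcross, hcross']
    linarith
  have hunit : IsUnit M := IsUnit.of_mul_eq_one X hMX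
  rw [← Matrix.inv_eq_right_inv hMX]
  exact (hpsd.posDef_iff_isUnit.2 hunit).inv

/-! ### An explicit curve of maximum determinant completions -/

/-- The diagonal entry `1 + α` of the completion with frequency `φ`. -/
noncomputable def waveDiag (m : ℕ) (φ : ℝ) : ℝ :=
  (Real.cos (Real.pi / m) * Real.sin (m * φ) + Real.sin φ) / Real.sin ((m - 1) * φ)

/-- The coefficient of `sin (t φ)` in the solution `x` with frequency `φ` of the recursion
`x (t - 1) + x (t + 1) = 2 cos φ * x t` that satisfies `x 1 = cos (π / m)` and `x m = -1`. -/
noncomputable def waveSlope (m : ℕ) (φ : ℝ) : ℝ :=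
  -(Real.cos φ + Real.cos (Real.pi / m) * Real.cos (m * φ)) / Real.sin ((m - 1) * φ)

/-- The solution of the recursion `x (t - 1) + x (t + 1) = 2 cos φ * x t` with
`x 1 = cos (π / m)` and `x m = -1`. -/
noncomputable def wave (m : ℕ) (φ t : ℝ) : ℝ :=
  waveDiag m φ * Real.cos (t * φ) + waveSlope m φ * Real.sin (t * φ)

/-- The off-diagonal entry of the inverse of `toeplitzMatrix m (wave m φ)`. -/
noncomputable def waveOff (m : ℕ) (φ : ℝ) : ℝ := 1 / (2 * waveSlope m φ * Real.sin φ)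

/-- The corner entry of the inverse of `toeplitzMatrix m (wave m φ)`. -/
noncomputable def waveCorner (m : ℕ) (φ : ℝ) : ℝ :=
  -waveOff m φ * (waveDiag m φ * wave m φ (m - 1) + wave m φ (-1)) / (waveDiag m φ ^ 2 - 1)

/-- The inverse of `toeplitzMatrix m (wave m φ)`. -/
noncomputable def waveInv (m : ℕ) (φ : ℝ) : Matrix (Fin (m + 1)) (Fin (m + 1)) ℝ :=
  cycleMatrix m (waveOff m φ * wave m φ (m - 1) + waveDiag m φ * waveCorner m φ)
    (-2 * waveOff m φ * Real.cos φ) (waveOff m φ) (waveCorner m φ)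

theorem wave_zero (m : ℕ) (φ : ℝ) : wave m φ 0 = waveDiag m φ := by simp [wave]

section

variable {m : ℕ} {φ : ℝ}

theorem wave_one (h : Real.sin ((m - 1) * φ) ≠ 0) : wave m φ 1 = Real.cos (Real.pi / m) := by
  rw [wave, waveDiag, waveSlope, div_mul_eq_mul_div, div_mul_eq_mul_div, ← add_div, div_eq_iff h,
    one_mul, sub_mul, one_mul, Real.sin_sub]
  ring

theorem wave_natCast (h : Real.sin ((m - 1) * φ) ≠ 0) : wave m φ m = -1 := by
  rw [wave, waveDiag, waveSlope, div_mul_eq_mul_div, div_mul_eq_mul_div, ← add_div, div_eq_iff h,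
    sub_mul, one_mul, Real.sin_sub]
  ring

theorem wave_sub_one_add_wave_add_one (m : ℕ) (φ t : ℝ) :
    wave m φ (t - 1) + wave m φ (t + 1) = 2 * Real.cos φ * wave m φ t := by
  simp only [wave, sub_mul, add_mul, one_mul, Real.cos_sub, Real.cos_add, Real.sin_sub,
    Real.sin_add]
  ring

theorem isCompletion_toeplitzMatrix_wave (hm : 2 ≤ m) (h : Real.sin ((m - 1) * φ) ≠ 0) :
    IsCompletion (m + 1) {1, m} (cycleData (m + 1) (waveDiag m φ - 1))
      (toeplitzMatrix m (wave m φ)) := by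
  constructor
  · ext i j
    simp only [toeplitzMatrix, Matrix.transpose_apply, Matrix.of_apply, abs_sub_comm]
  · intro i j hij hp
    have hij' : (i : ℕ) ≤ j := hij
    have hij'' : (i : ℝ) ≤ j := by exact_mod_cast hij'
    rw [toeplitzMatrix, Matrix.of_apply, abs_sub_comm, abs_of_nonneg (sub_nonneg.2 hij''),
      ← Nat.cast_sub hij']
    simp only [Finset.mem_insert, Finset.mem_singleton] at hp
    rcases hp with hp | hp | hp <;> rw [hp]
    · simp [cycleData_zero, wave_zero]
    · simp [cycleData_one, wave_one h]
    · rw [wave_natCast h, cycleData_of_two_le _ _ hm]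

theorem sin_natCast_mul_pos (hm : 2 ≤ m) (h0 : 0 < φ) (h1 : φ < Real.pi / m) :
    0 < Real.sin φ ∧ 0 < Real.sin ((m - 1) * φ) ∧ 0 < Real.sin (m * φ) := by
  have hm' : (2 : ℝ) ≤ m := by exact_mod_cast hm
  have hlt : m * φ < Real.pi := by
    rw [lt_div_iff₀ (by linarith)] at h1
    linarith
  refine ⟨Real.sin_pos_of_pos_of_lt_pi h0 ?_, Real.sin_pos_of_pos_of_lt_pi ?_ ?_,
    Real.sin_pos_of_pos_of_lt_pi ?_ hlt⟩ <;> nlinarith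

theorem waveSlope_neg (hm : 2 ≤ m) (h0 : 0 < φ) (h1 : φ < Real.pi / m) : waveSlope m φ < 0 := by
  have hm' : (2 : ℝ) ≤ m := by exact_mod_cast hm
  have hle : Real.pi / m ≤ Real.pi / 2 :=
    div_le_div_of_nonneg_left Real.pi_pos.le two_pos hm'
  have hcos : Real.cos (Real.pi / m) < Real.cos φ :=
    Real.cos_lt_cos_of_nonneg_of_le_pi h0.le (by linarith [Real.pi_pos]) h1
  have hcos0 : 0 ≤ Real.cos (Real.pi / m) :=
    Real.cos_nonneg_of_neg_pi_div_two_le_of_le (by linarith [Real.pi_pos]) hle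
  refine div_neg_of_neg_of_pos ?_ (sin_natCast_mul_pos hm h0 h1).2.1
  nlinarith [Real.neg_one_le_cos (m * φ)]

theorem waveInv_mul (hm : 2 ≤ m) (h0 : 0 < φ) (h1 : φ < Real.pi / m) (hs : 1 < waveDiag m φ) :
    waveInv m φ * toeplitzMatrix m (wave m φ) = 1 := by
  obtain ⟨hsin, hsin1, hsinm⟩ := sin_natCast_mul_pos hm h0 h1
  have hq := waveSlope_neg hm h0 h1
  have hs2 : waveDiag m φ ^ 2 - 1 ≠ 0 := by nlinarith
  have hxm := wave_natCast hsin1.ne'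
  have hd : waveCorner m φ * (waveDiag m φ ^ 2 - 1) =
      -waveOff m φ * (waveDiag m φ * wave m φ (m - 1) + wave m φ (-1)) := by
    rw [waveCorner, div_mul_cancel₀ _ hs2]
  refine cycleMatrix_mul_toeplitzMatrix hm (fun t => ?_) (fun t => ?_) ?_
  · linear_combination waveOff m φ * wave_sub_one_add_wave_add_one m φ t
  · -- the left hand side is a combination of `cos (t φ)` and `sin (t φ)` that vanishes at `0` and `m`
    set c := waveOff m φ
    set d := waveCorner m φ
    set s := waveDiag m φ with hs'
    set a := c * wave m φ (m - 1) + s * d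
    obtain ⟨G, H, hGH⟩ : ∃ G H : ℝ, ∀ t, a * wave m φ t + c * wave m φ (t - 1) +
        d * wave m φ (m - t) = G * Real.cos (t * φ) + H * Real.sin (t * φ) := by
      refine ⟨a * s + c * (s * Real.cos φ - waveSlope m φ * Real.sin φ) +
          d * (s * Real.cos (m * φ) + waveSlope m φ * Real.sin (m * φ)),
        a * waveSlope m φ + c * (s * Real.sin φ + waveSlope m φ * Real.cos φ) +
          d * (s * Real.sin (m * φ) - waveSlope m φ * Real.cos (m * φ)), fun t => ?_⟩
      simp only [wave, ← hs', sub_mul, one_mul, Real.cos_sub, Real.sin_sub]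
      ring
    have hG : G = 0 := by
      have := hGH 0
      simp only [zero_mul, Real.cos_zero, Real.sin_zero, zero_sub, sub_zero, wave_zero, hxm,
        mul_one, mul_zero, add_zero] at this
      rw [← this]
      linear_combination hd
    have hH : H = 0 := by
      have := hGH m
      rw [hG, sub_self, wave_zero, hxm, zero_mul, zero_add] at this
      refine (mul_eq_zero.1 (this.symm.trans ?_)).resolve_right hsinm.ne'
      simp only [a, ← hs']
      ring
    rw [hGH, hG, hH, zero_mul, zero_mul, add_zero]
  · have : wave m φ 1 - wave m φ (-1) = 2 * waveSlope m φ * Real.sin φ := by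
      simp only [wave, one_mul, neg_mul, Real.cos_neg, Real.sin_neg]
      ring
    rw [this, waveOff]
    exact one_div_mul_cancel (mul_ne_zero (mul_ne_zero two_ne_zero hq.ne) hsin.ne')

theorem posDef_toeplitzMatrix_wave (hm : 2 ≤ m) (h0 : 0 < φ) (h1 : φ < Real.pi / m)
    (hs : 1 < waveDiag m φ) : (toeplitzMatrix m (wave m φ)).PosDef := by
  obtain ⟨hsin, hsin1, -⟩ := sin_natCast_mul_pos hm h0 h1
  have hm0 : (0 : ℝ) < m := by positivity
  refine posDef_of_mul_eq_one_of_ends (inCyclePattern_cycleMatrix _ _ _ _ _).1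
    (waveInv_mul hm h0 h1 hs) hs ?_ ?_ ?_ ?_ fun r hr0 hrm =>
      dotProduct_cycleMatrix_mulVec_nonneg hm h0 ?_ ?_ rfl hr0 hrm
  · simp [toeplitzMatrix, wave_zero]
  · simp [toeplitzMatrix, wave_natCast hsin1.ne']
  · simp [toeplitzMatrix, wave_natCast hsin1.ne']
  · simp [toeplitzMatrix, wave_zero]
  · rwa [lt_div_iff₀ hm0, mul_comm] at h1
  · refine one_div_nonpos.2 ?_
    have := mul_neg_of_neg_of_pos (waveSlope_neg hm h0 h1) hsin
    linarith

/-- Every completion `Y` satisfies `tr (X⁻¹ Y) = m + 1` for `X = toeplitzMatrix m (wave m φ)`, because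
`X⁻¹` is supported on the cycle. -/
theorem IsMaxDetCompletion.eq_toeplitzMatrix_wave (hm : 2 ≤ m) (h0 : 0 < φ)
    (h1 : φ < Real.pi / m) (hs : 1 < waveDiag m φ) {Y : Matrix (Fin (m + 1)) (Fin (m + 1)) ℝ}
    (hY : IsMaxDetCompletion (m + 1) {1, m} (cycleData (m + 1) (waveDiag m φ - 1)) Y) :
    Y = toeplitzMatrix m (wave m φ) ∧ Y⁻¹ = waveInv m φ := by
  have hX := posDef_toeplitzMatrix_wave hm h0 h1 hs
  have hc := isCompletion_toeplitzMatrix_wave hm (sin_natCast_mul_pos hm h0 h1).2.1.ne'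
  have hmul := waveInv_mul hm h0 h1 hs
  have hYX : Y = toeplitzMatrix m (wave m φ) := by
    refine eq_of_trace_inv_mul_le_of_det_le hX hY.1.2 (le_of_eq ?_) (hY.2 _ hc hX)
    rw [Matrix.inv_eq_left_inv hmul, waveInv,
      (inCyclePattern_cycleMatrix _ _ _ _ _).trace_mul_eq hY.1.1 hc, ← waveInv, hmul,
      Matrix.trace_one]
  exact ⟨hYX, by rw [hYX, Matrix.inv_eq_left_inv hmul]⟩

end

/-! ### The limit of the curve -/

theorem tendsto_div_of_hasDerivAt {f g : ℝ → ℝ} {f' g' x : ℝ} (hf : HasDerivAt f f' x)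
    (hf0 : f x = 0) (hg : HasDerivAt g g' x) (hg0 : g x = 0) (hg' : g' ≠ 0) :
    Tendsto (fun y => f y / g y) (𝓝[<] x) (𝓝 (f' / g')) := by
  have hle : 𝓝[<] x ≤ 𝓝[≠] x := nhdsWithin_mono _ fun y hy => ne_of_lt hy
  have h := ((hasDerivAt_iff_tendsto_slope.1 hf).mono_left hle).div
    ((hasDerivAt_iff_tendsto_slope.1 hg).mono_left hle) hg'
  refine h.congr' ?_
  filter_upwards [self_mem_nhdsWithin] with y hy
  have hyx : y - x ≠ 0 := sub_ne_zero.2 (ne_of_lt hy)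
  simp only [Pi.div_apply, slope_def_field, hf0, hg0, sub_zero]
  exact div_div_div_cancel_right₀ hyx _ _

section

variable {m : ℕ}

theorem natCast_mul_pi_div (hm : 2 ≤ m) : (m : ℝ) * (Real.pi / m) = Real.pi :=
  mul_div_cancel₀ _ (by positivity)

theorem natCast_sub_one_mul_pi_div (hm : 2 ≤ m) :
    ((m : ℝ) - 1) * (Real.pi / m) = Real.pi - Real.pi / m := by
  rw [sub_mul, one_mul, natCast_mul_pi_div hm]

theorem sin_pi_div_pos (hm : 2 ≤ m) : 0 < Real.sin (Real.pi / m) := by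
  have hm0 : (0 : ℝ) < m := by positivity
  exact Real.sin_pos_of_pos_of_lt_pi (by positivity)
    (div_lt_self Real.pi_pos (by exact_mod_cast hm))

theorem hasDerivAt_sin_const_mul (k x : ℝ) :
    HasDerivAt (fun φ => Real.sin (k * φ)) (k * Real.cos (k * x)) x := by
  have h : HasDerivAt (fun φ : ℝ => k * φ) k x := by
    simpa using (hasDerivAt_id x).const_mul k
  simpa [mul_comm] using h.sin

theorem hasDerivAt_cos_const_mul (k x : ℝ) :
    HasDerivAt (fun φ => Real.cos (k * φ)) (-(k * Real.sin (k * x))) x := by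
  have h : HasDerivAt (fun φ : ℝ => k * φ) k x := by
    simpa using (hasDerivAt_id x).const_mul k
  simpa [mul_comm] using h.cos

theorem waveDiag_pi_div (hm : 2 ≤ m) : waveDiag m (Real.pi / m) = 1 := by
  rw [waveDiag, natCast_mul_pi_div hm, natCast_sub_one_mul_pi_div hm, Real.sin_pi, Real.sin_pi_sub,
    mul_zero, zero_add, div_self (sin_pi_div_pos hm).ne']

theorem waveSlope_pi_div (hm : 2 ≤ m) : waveSlope m (Real.pi / m) = 0 := by
  rw [waveSlope, natCast_mul_pi_div hm, Real.cos_pi]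
  simp

/-- The value `1` of the diagonal entry is critical, so `α` is of second order in `π / m - φ`. -/
theorem hasDerivAt_waveDiag (hm : 2 ≤ m) : HasDerivAt (waveDiag m) 0 (Real.pi / m) := by
  have hsin := sin_pi_div_pos hm
  have h := (((hasDerivAt_sin_const_mul m (Real.pi / m)).const_mul (Real.cos (Real.pi / m))).add
    (Real.hasDerivAt_sin (Real.pi / m))).div (hasDerivAt_sin_const_mul (m - 1) (Real.pi / m))
    (by rw [natCast_sub_one_mul_pi_div hm, Real.sin_pi_sub]; exact hsin.ne')
  refine h.congr_deriv ?_
  simp only [Pi.add_apply, natCast_mul_pi_div hm, natCast_sub_one_mul_pi_div hm, Real.cos_pi,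
    Real.sin_pi, Real.sin_pi_sub, Real.cos_pi_sub]
  field_simp
  ring

theorem hasDerivAt_waveSlope (hm : 2 ≤ m) : HasDerivAt (waveSlope m) 1 (Real.pi / m) := by
  have hsin := sin_pi_div_pos hm
  have h := (((Real.hasDerivAt_cos (Real.pi / m)).add ((hasDerivAt_cos_const_mul m
    (Real.pi / m)).const_mul (Real.cos (Real.pi / m)))).neg).div
    (hasDerivAt_sin_const_mul (m - 1) (Real.pi / m))
    (by rw [natCast_sub_one_mul_pi_div hm, Real.sin_pi_sub]; exact hsin.ne')
  refine h.congr_deriv ?_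
  simp only [Pi.add_apply, Pi.neg_apply, natCast_mul_pi_div hm, natCast_sub_one_mul_pi_div hm,
    Real.cos_pi, Real.sin_pi, Real.sin_pi_sub, Real.cos_pi_sub]
  field_simp
  ring

theorem hasDerivAt_wave (hm : 2 ≤ m) (t : ℝ) : HasDerivAt (fun φ => wave m φ t)
    (-(t * Real.sin (t * (Real.pi / m))) + Real.sin (t * (Real.pi / m))) (Real.pi / m) := by
  have h := ((hasDerivAt_waveDiag hm).mul (hasDerivAt_cos_const_mul t (Real.pi / m))).add
    ((hasDerivAt_waveSlope hm).mul (hasDerivAt_sin_const_mul t (Real.pi / m)))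
  refine h.congr_deriv ?_
  rw [waveDiag_pi_div hm, waveSlope_pi_div hm]
  ring

theorem wave_pi_div (hm : 2 ≤ m) (t : ℝ) :
    wave m (Real.pi / m) t = Real.cos (t * (Real.pi / m)) := by
  rw [wave, waveDiag_pi_div hm, waveSlope_pi_div hm]
  ring

theorem eventually_mem_Ioo (hm : 2 ≤ m) :
    ∀ᶠ φ in 𝓝[<] (Real.pi / m), 0 < φ ∧ φ < Real.pi / m := by
  have hm0 : (0 : ℝ) < m := by positivity
  exact Ioo_mem_nhdsLT (by positivity : 0 < Real.pi / m)

/-- The sign of `waveDiag m φ - 1` is that of the function `g` below, which has a simple zero at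
`π / m`. -/
theorem eventually_one_lt_waveDiag (hm : 3 ≤ m) :
    ∀ᶠ φ in 𝓝[<] (Real.pi / m), 1 < waveDiag m φ := by
  have hm3 : (3 : ℝ) ≤ m := by exact_mod_cast hm
  have hsin := sin_pi_div_pos (m := m) (by omega)
  have hhalf : (m : ℝ) / 2 * (Real.pi / m) = Real.pi / 2 := by
    rw [div_mul_eq_mul_div, natCast_mul_pi_div (by omega)]
  set g : ℝ → ℝ := fun φ => Real.cos (Real.pi / m) * Real.sin (m / 2 * φ) -
    Real.sin ((m / 2 - 1) * φ) with hg
  have hg0 : g (Real.pi / m) = 0 := by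
    simp only [hg, sub_mul, one_mul, hhalf, Real.sin_pi_div_two, Real.sin_pi_div_two_sub, mul_one,
      sub_self]
  have hg' : HasDerivAt g (-((m / 2 - 1) * Real.sin (Real.pi / m))) (Real.pi / m) := by
    have h := ((hasDerivAt_sin_const_mul (m / 2) (Real.pi / m)).const_mul
      (Real.cos (Real.pi / m))).sub (hasDerivAt_sin_const_mul (m / 2 - 1) (Real.pi / m))
    refine h.congr_deriv ?_
    rw [hhalf, Real.cos_pi_div_two, show ((m : ℝ) / 2 - 1) * (Real.pi / m) =
      Real.pi / 2 - Real.pi / m by rw [sub_mul, one_mul, hhalf], Real.cos_pi_div_two_sub]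
    ring
  have hlim := tendsto_div_of_hasDerivAt hg' hg0 ((hasDerivAt_id (Real.pi / m)).sub_const
    (Real.pi / m)) (by simp) one_ne_zero
  have hneg : -((m / 2 - 1) * Real.sin (Real.pi / m)) / 1 < 0 := by
    rw [div_one]
    nlinarith
  filter_upwards [hlim.eventually_lt_const hneg, eventually_mem_Ioo (m := m) (by omega)] with φ h hφ
  obtain ⟨hφ0, hφ1⟩ := hφ
  have hgpos : 0 < g φ := by
    have hd : id φ - Real.pi / m < 0 := by simpa using hφ1
    by_contra! hle
    exact absurd h (not_lt.2 (div_nonneg_of_nonpos hle hd.le))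
  have hc : 0 < Real.cos (m / 2 * φ) := by
    refine Real.cos_pos_of_mem_Ioo ⟨?_, ?_⟩
    · have : 0 < (m : ℝ) / 2 * φ := by positivity
      linarith [Real.pi_pos]
    · rw [← hhalf]
      exact mul_lt_mul_of_pos_left hφ1 (by positivity)
  rw [waveDiag, one_lt_div (sin_natCast_mul_pos (by omega) hφ0 hφ1).2.1, ← sub_pos]
  -- the numerator minus the denominator of `waveDiag m φ`
  have key : Real.cos (Real.pi / m) * Real.sin (m * φ) + Real.sin φ - Real.sin ((m - 1) * φ) =
      2 * Real.cos (m / 2 * φ) * g φ := by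
    have e1 : (m : ℝ) * φ = 2 * (m / 2 * φ) := by ring
    have e2 : ((m : ℝ) - 1) * φ = m / 2 * φ + (m / 2 - 1) * φ := by ring
    have e3 : Real.sin φ = Real.sin (m / 2 * φ - (m / 2 - 1) * φ) := by ring_nf
    rw [e1, e2, e3, Real.sin_two_mul, Real.sin_add, Real.sin_sub]
    ring
  rw [key]
  positivity

/-- Every small `α > 0` is attained by the curve, near its endpoint. -/
theorem nhdsGT_zero_le_map_waveDiag (hm : 3 ≤ m) :
    𝓝[>] (0 : ℝ) ≤ map (fun φ => waveDiag m φ - 1) (𝓝[<] (Real.pi / m)) := by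
  intro U hU
  have hpos : 0 < Real.pi / m := by positivity
  obtain ⟨φ₀, hφ₀, hsub⟩ := (mem_nhdsLT_iff_exists_Ioo_subset' hpos).1 hU
  obtain ⟨φ₁, ⟨hdiag, hφ₁⟩, hφ₁'⟩ := ((eventually_one_lt_waveDiag hm).and
    (Ioo_mem_nhdsLT (max_lt hφ₀ hpos))).and (eventually_mem_Ioo (m := m) (by omega)) |>.exists
  have hcont : ContinuousOn (fun φ => waveDiag m φ - 1) (Set.Icc φ₁ (Real.pi / m)) := by
    refine ContinuousOn.sub (ContinuousOn.div (by fun_prop) (by fun_prop) fun φ hφ => ?_)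
      continuousOn_const
    rcases hφ.2.eq_or_lt with h | h
    · rw [h, natCast_sub_one_mul_pi_div (by omega), Real.sin_pi_sub]
      exact (sin_pi_div_pos (by omega)).ne'
    · exact (sin_natCast_mul_pos (by omega) (hφ₁'.1.trans_le hφ.1) h).2.1.ne'
  filter_upwards [Ioo_mem_nhdsGT (sub_pos.2 hdiag)] with α hα
  obtain ⟨φ, hφ, rfl⟩ := intermediate_value_Icc' hφ₁'.2.le hcont
    (show α ∈ Set.Icc _ _ by simpa [waveDiag_pi_div (by omega : 2 ≤ m)] using ⟨hα.1.le, hα.2.le⟩)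
  refine hsub ⟨(le_max_left _ _).trans_lt (hφ₁.1.trans_le hφ.1), hφ.2.lt_of_ne ?_⟩
  rintro rfl
  simp [waveDiag_pi_div (by omega : 2 ≤ m)] at hα

theorem tendsto_toeplitzMatrix_wave (hm : 2 ≤ m) :
    Tendsto (fun φ => toeplitzMatrix m (wave m φ)) (𝓝[<] (Real.pi / m))
      (𝓝 (cosMatrix (m + 1))) := by
  refine tendsto_pi_nhds.2 fun i => tendsto_pi_nhds.2 fun j => ?_
  have h := (hasDerivAt_wave hm |(i : ℝ) - (j : ℝ)|).continuousAt.tendsto.mono_left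
    (nhdsWithin_le_nhds (s := Set.Iio (Real.pi / m)))
  have e : Real.cos (|(i : ℝ) - (j : ℝ)| * (Real.pi / m)) = cosMatrix (m + 1) i j := by
    rw [cosMatrix_succ_apply]
    rcases abs_choice ((i : ℝ) - (j : ℝ)) with h | h <;> rw [h]
    rw [neg_mul, Real.cos_neg]
  rw [wave_pi_div hm, e] at h
  exact h

theorem tendsto_mul_waveOff (hm : 2 ≤ m) :
    Tendsto (fun φ => (waveDiag m φ - 1) * waveOff m φ) (𝓝[<] (Real.pi / m)) (𝓝 0) := by
  have hsin := sin_pi_div_pos hm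
  have h1 := tendsto_div_of_hasDerivAt ((hasDerivAt_waveDiag hm).sub_const 1)
    (by rw [waveDiag_pi_div hm, sub_self]) (hasDerivAt_waveSlope hm) (waveSlope_pi_div hm)
    one_ne_zero
  have h2 : Tendsto (fun φ => 2 * Real.sin φ) (𝓝[<] (Real.pi / m))
      (𝓝 (2 * Real.sin (Real.pi / m))) :=
    (Continuous.tendsto (by fun_prop) _).mono_left nhdsWithin_le_nhds
  have h := h1.div h2 (by positivity)
  rw [zero_div, zero_div] at h
  refine h.congr fun φ => ?_
  simp only [Pi.div_apply, waveOff]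
  rw [div_div, mul_one_div]
  ring

/-- By `hasDerivAt_wave`, the numerator of the corner entry vanishes to first order at `π / m`. -/
theorem tendsto_mul_waveCorner (hm : 3 ≤ m) :
    Tendsto (fun φ => (waveDiag m φ - 1) * waveCorner m φ) (𝓝[<] (Real.pi / m))
      (𝓝 (m / 4)) := by
  have hm2 : 2 ≤ m := by omega
  have hsin := sin_pi_div_pos hm2
  have hN : HasDerivAt (fun φ => waveDiag m φ * wave m φ (m - 1) + wave m φ (-1))
      (-(m * Real.sin (Real.pi / m))) (Real.pi / m) := by
    have h := ((hasDerivAt_waveDiag hm2).mul (hasDerivAt_wave hm2 (m - 1))).add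
      (hasDerivAt_wave hm2 (-1))
    refine h.congr_deriv ?_
    simp only [waveDiag_pi_div hm2, wave_pi_div hm2, natCast_sub_one_mul_pi_div hm2,
      Real.sin_pi_sub, neg_mul, one_mul, Real.sin_neg]
    ring
  have hN0 : waveDiag m (Real.pi / m) * wave m (Real.pi / m) (m - 1) +
      wave m (Real.pi / m) (-1) = 0 := by
    simp only [waveDiag_pi_div hm2, wave_pi_div hm2, natCast_sub_one_mul_pi_div hm2,
      Real.cos_pi_sub, neg_mul, one_mul, Real.cos_neg]
    ring
  have h1 := tendsto_div_of_hasDerivAt hN hN0 (hasDerivAt_waveSlope hm2) (waveSlope_pi_div hm2)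
    one_ne_zero
  have h2 : Tendsto (fun φ => -(2 * Real.sin φ * (waveDiag m φ + 1))) (𝓝[<] (Real.pi / m))
      (𝓝 (-(2 * Real.sin (Real.pi / m) * (waveDiag m (Real.pi / m) + 1)))) := by
    refine Tendsto.mono_left ?_ nhdsWithin_le_nhds
    have hc := (hasDerivAt_waveDiag hm2).continuousAt
    exact (((Continuous.tendsto (by fun_prop) _).mul (hc.tendsto.add_const 1)).neg)
  rw [waveDiag_pi_div hm2] at h2
  have h := h1.div h2 (by rw [neg_ne_zero]; positivity)
  have hval : -(m * Real.sin (Real.pi / m)) / 1 / -(2 * Real.sin (Real.pi / m) * (1 + 1)) =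
      (m : ℝ) / 4 := by
    field_simp
    norm_num
  rw [hval] at h
  refine h.congr' ?_
  filter_upwards [eventually_one_lt_waveDiag hm, eventually_mem_Ioo hm2] with φ hs hφ
  have hq := (waveSlope_neg hm2 hφ.1 hφ.2).ne
  have hsφ := (sin_natCast_mul_pos hm2 hφ.1 hφ.2).1.ne'
  have e1 : waveDiag m φ - 1 ≠ 0 := by linarith
  have e2 : waveDiag m φ + 1 ≠ 0 := by linarith
  have e3 : waveDiag m φ ^ 2 - 1 = (waveDiag m φ - 1) * (waveDiag m φ + 1) := by ring
  simp only [Pi.div_apply, waveCorner, waveOff, e3]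
  field_simp

theorem smul_cycleMatrix (r a b c d : ℝ) :
    r • cycleMatrix m a b c d = cycleMatrix m (r * a) (r * b) (r * c) (r * d) := by
  ext i j
  simp only [cycleMatrix, Matrix.smul_apply, Matrix.of_apply, smul_eq_mul, mul_ite, mul_zero]

theorem tendsto_cycleMatrix {ι : Type*} {l : Filter ι} {a b c d : ι → ℝ} {a' b' c' d' : ℝ}
    (ha : Tendsto a l (𝓝 a')) (hb : Tendsto b l (𝓝 b')) (hc : Tendsto c l (𝓝 c'))
    (hd : Tendsto d l (𝓝 d')) : Tendsto (fun i => cycleMatrix m (a i) (b i) (c i) (d i)) l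
      (𝓝 (cycleMatrix m a' b' c' d')) := by
  refine tendsto_pi_nhds.2 fun i => tendsto_pi_nhds.2 fun j => ?_
  simp only [cycleMatrix, Matrix.of_apply]
  split_ifs
  exacts [ha, hb, hc, hd, tendsto_const_nhds]

theorem cycleMatrix_zero_zero (hm : 2 ≤ m) (a : ℝ) :
    cycleMatrix m a 0 0 a = a • Matrix.vecMulVec (endsVec m) (endsVec m) := by
  ext i j
  simp only [cycleMatrix, Matrix.of_apply, vecMulVec_endsVec, Matrix.smul_apply, Matrix.add_apply,
    Matrix.single_apply, Fin.ext_iff, Fin.val_zero, Fin.val_last, smul_eq_mul]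
  split_ifs <;> first | omega | simp

theorem tendsto_smul_waveInv (hm : 3 ≤ m) :
    Tendsto (fun φ => (waveDiag m φ - 1) • waveInv m φ) (𝓝[<] (Real.pi / m))
      (𝓝 ((m / 4 : ℝ) • Matrix.vecMulVec (endsVec m) (endsVec m))) := by
  have hm2 : 2 ≤ m := by omega
  have hc := tendsto_mul_waveOff hm2
  have hd := tendsto_mul_waveCorner hm
  have hx := (hasDerivAt_wave hm2 (m - 1)).continuousAt.tendsto.mono_left
    (nhdsWithin_le_nhds (s := Set.Iio (Real.pi / m)))
  have hs := (hasDerivAt_waveDiag hm2).continuousAt.tendsto.mono_left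
    (nhdsWithin_le_nhds (s := Set.Iio (Real.pi / m)))
  have hcos : Tendsto (fun φ => -2 * Real.cos φ) (𝓝[<] (Real.pi / m))
      (𝓝 (-2 * Real.cos (Real.pi / m))) :=
    (Continuous.tendsto (by fun_prop) _).mono_left nhdsWithin_le_nhds
  rw [waveDiag_pi_div hm2] at hs
  rw [← cycleMatrix_zero_zero hm2]
  simp only [waveInv, smul_cycleMatrix]
  refine tendsto_cycleMatrix ?_ ?_ hc hd
  · have h := (hc.mul hx).add (hs.mul hd)
    rw [zero_mul, zero_add, one_mul] at h
    exact h.congr fun φ => by ring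
  · have h := hc.mul hcos
    rw [zero_mul] at h
    exact h.congr fun φ => by ring

/-- A function of `α` whose values along the curve are known has the limit of these values. -/
theorem tendsto_nhdsGT_zero_of_waveDiag (hm : 3 ≤ m) {β : Type*} {F G : ℝ → β} {l : Filter β}
    (hFG : ∀ φ, 0 < φ → φ < Real.pi / m → 1 < waveDiag m φ → F (waveDiag m φ - 1) = G φ)
    (hG : Tendsto G (𝓝[<] (Real.pi / m)) l) : Tendsto F (𝓝[>] 0) l := by
  refine Tendsto.mono_left ?_ (nhdsGT_zero_le_map_waveDiag hm)
  rw [tendsto_map'_iff]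
  refine hG.congr' ?_
  filter_upwards [eventually_one_lt_waveDiag hm, eventually_mem_Ioo (m := m) (by omega)] with φ hs hφ
  exact (hFG φ hφ.1 hφ.2 hs).symm

end

end ToeplitzCompletion

theorem mainTheorem6 (n : ℕ) (hn : 4 ≤ n) :
    -- for `α = 0` the only positive semidefinite completion is `cosMatrix n`, of rank two
    ToeplitzCompletion.psdCompletions n {1, n - 1} (ToeplitzCompletion.cycleData n 0) =
        {ToeplitzCompletion.cosMatrix n} ∧
    (ToeplitzCompletion.cosMatrix n).rank = 2 ∧
    -- for `α > 0` the maximum determinant completion exists and is unique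
    (∀ α : ℝ, 0 < α → ∃! X : Matrix (Fin n) (Fin n) ℝ,
      ToeplitzCompletion.IsMaxDetCompletion n {1, n - 1}
        (ToeplitzCompletion.cycleData n α) X) ∧
    -- its behaviour as `α` decreases to zero
    (∀ X : ℝ → Matrix (Fin n) (Fin n) ℝ,
      (∀ α : ℝ, 0 < α → ToeplitzCompletion.IsMaxDetCompletion n {1, n - 1}
        (ToeplitzCompletion.cycleData n α) (X α)) →
      Tendsto X (𝓝[>] 0) (𝓝 (ToeplitzCompletion.cosMatrix n)) ∧
      ∃ Zbar : Matrix (Fin n) (Fin n) ℝ,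
        Tendsto (fun α : ℝ => α • (X α)⁻¹) (𝓝[>] 0) (𝓝 Zbar) ∧
        Zbar.PosSemidef ∧
        (ToeplitzCompletion.completionSDP n {1, n - 1}
          (ToeplitzCompletion.cycleData n 0)).InAdjointRange Zbar ∧
        ToeplitzCompletion.cosMatrix n * Zbar = 0 ∧
        Zbar.rank ≤ 1 ∧
        (ToeplitzCompletion.cosMatrix n).rank + Zbar.rank ≤ 3 ∧
        (ToeplitzCompletion.cosMatrix n).rank + Zbar.rank < n) ∧
    -- the singularity degree of the completion problem for `α = 0`
    2 ≤ (ToeplitzCompletion.completionSDP n {1, n - 1}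
      (ToeplitzCompletion.cycleData n 0)).singularityDegree := by
  obtain ⟨m, rfl⟩ : ∃ m, n = m + 1 := ⟨n - 1, by omega⟩
  have hm : 3 ≤ m := by omega
  have hm2 : 2 ≤ m := by omega
  rw [Nat.add_sub_cancel]
  refine ⟨ToeplitzCompletion.psdCompletions_zero hm2, ToeplitzCompletion.rank_cosMatrix hm2,
    fun α hα => ?_, fun X hX => ?_, ToeplitzCompletion.two_le_singularityDegree hm⟩
  · -- `cosMatrix + α • 1` is a positive definite completion
    refine ToeplitzCompletion.existsUnique_isMaxDetCompletion
      (Y := ToeplitzCompletion.cosMatrix (m + 1) + α • 1) ⟨?_, fun i j hij hp => ?_⟩ ?_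
    · exact (ToeplitzCompletion.isCompletion_cosMatrix hm2).1.add (Matrix.isSymm_one.smul α)
    · rw [Matrix.add_apply, (ToeplitzCompletion.isCompletion_cosMatrix hm2).2 i j hij hp,
        Matrix.smul_apply]
      rcases hij.eq_or_lt with rfl | hlt
      · simp [ToeplitzCompletion.cycleData_zero]
      · have h0 : (j : ℕ) - (i : ℕ) ≠ 0 := by
          have : (i : ℕ) < j := hlt
          omega
        rw [Matrix.one_apply_ne hlt.ne]
        simp [ToeplitzCompletion.cycleData, h0]
    · exact (Matrix.PosDef.one.smul hα).posSemidef_add (ToeplitzCompletion.posSemidef_cosMatrix m)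
  · have hcurve : ∀ φ, 0 < φ → φ < Real.pi / m → 1 < ToeplitzCompletion.waveDiag m φ →
        X (ToeplitzCompletion.waveDiag m φ - 1) =
          ToeplitzCompletion.toeplitzMatrix m (ToeplitzCompletion.wave m φ) ∧
        (X (ToeplitzCompletion.waveDiag m φ - 1))⁻¹ = ToeplitzCompletion.waveInv m φ :=
      fun φ h0 h1 hs => (hX _ (sub_pos.2 hs)).eq_toeplitzMatrix_wave hm2 h0 h1 hs
    have hrank : ((m / 4 : ℝ) • Matrix.vecMulVec (ToeplitzCompletion.endsVec m)
        (ToeplitzCompletion.endsVec m)).rank ≤ 1 := by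
      rw [← Matrix.smul_vecMulVec]
      exact Matrix.rank_vecMulVec_le _ _
    refine ⟨ToeplitzCompletion.tendsto_nhdsGT_zero_of_waveDiag hm
      (fun φ h0 h1 hs => (hcurve φ h0 h1 hs).1) (ToeplitzCompletion.tendsto_toeplitzMatrix_wave hm2),
      _, ToeplitzCompletion.tendsto_nhdsGT_zero_of_waveDiag hm
      (fun φ h0 h1 hs => by rw [(hcurve φ h0 h1 hs).2])
      (ToeplitzCompletion.tendsto_smul_waveInv hm), ?_,
      ToeplitzCompletion.inAdjointRange_smul_endsVec m _ _, ?_, hrank, ?_, ?_⟩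
    · exact (Matrix.posSemidef_vecMulVec_self_star _).smul (by positivity)
    · rw [Matrix.mul_smul, Matrix.mul_vecMulVec,
        ToeplitzCompletion.cosMatrix_mulVec_endsVec (by omega), Matrix.zero_vecMulVec, smul_zero]
    · rw [ToeplitzCompletion.rank_cosMatrix hm2]
      omega
    · rw [ToeplitzCompletion.rank_cosMatrix hm2]
      omega
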